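/- For a finite simple graph $G$ with $m$ edges, let $\mathrm{mc}(G)$ be the number of edges in a largest bipartite subgraph (equivalently, a largest cut) of $G$, and let $\mathrm{sp}(G)=\mathrm{mc}(G)-m/2$ be its surplus. For a graph $H$ and a positive integer $m$, let $\mathrm{sp}(m,H)$ be the smallest value of $\mathrm{sp}(G)$ over all graphs $G$ with exactly $m$ edges that contain no (not necessarily induced) copy of $H$ as a subgraph. For $k\ge 2$, let $W_{2k}$ be the even wheel obtained by joining a new vertex to all the vertices of a cycle $C_{2k}$ of length $2k$. Then for every integer $k\ge 2$, $\mathrm{sp}(m,W_{2k})=\Theta(m^{4/5})$; that is, there are constants $c,C>0$ depending only on $k$ such that for every integer $m\ge 1$ $$c\,m^{4/5}\le \mathrm{sp}(m,W_{2k})\le C\,m^{4/5}.$$ -/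

import Mathlib

namespace MaxCutSurplus

/-- `maxCut G` is the number of edges in a largest bipartite subgraph of the finite graph `G`,
that is, the size of a largest cut: the maximum over all vertex sets `s` of the number of edges
of `G` between `s` and its complement. -/
noncomputable def maxCut {V : Type*} [Fintype V] (G : SimpleGraph V) : ℕ :=
  (Finset.univ : Finset (Finset V)).sup
    fun s => (G.between (s : Set V) (s : Set V)ᶜ).edgeSet.ncard

/-- The surplus `mc(G) - m / 2` of a finite graph `G` with `m` edges. -/
noncomputable def surplus {V : Type*} [Fintype V] (G : SimpleGraph V) : ℝ :=
  (maxCut G : ℝ) - (G.edgeSet.ncard : ℝ) / 2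

/-- The set of all values `sp(G)`, where `G` runs over the (finite) `H`-free graphs with exactly
`m` edges. -/
def surplusValues {W : Type*} (m : ℕ) (H : SimpleGraph W) : Set ℝ :=
  {x | ∃ (n : ℕ) (G : SimpleGraph (Fin n)), H.Free G ∧ G.edgeSet.ncard = m ∧ surplus G = x}

/-- `sp(m, H)`: the smallest possible value of `sp(G)` over all `H`-free graphs `G` with `m`
edges. -/
noncomputable def sp {W : Type*} (m : ℕ) (H : SimpleGraph W) : ℝ :=
  sInf (surplusValues m H)

/-- The infimum in the definition of `sp m H` is a minimum as soon as some `H`-free graph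
with `m` edges exists. -/
theorem sp_isLeast {W : Type*} (m : ℕ) (H : SimpleGraph W) (h : (surplusValues m H).Nonempty) :
    IsLeast (surplusValues m H) (sp m H) := by
  classical
  have hex : ∃ N : ℕ, ((N : ℝ) - (m : ℝ) / 2) ∈ surplusValues m H := by
    obtain ⟨x, n, G, hG, hm, hx⟩ := h
    exact ⟨maxCut G, n, G, hG, hm, by simp [surplus, hm]⟩
  have hl : IsLeast (surplusValues m H) ((Nat.find hex : ℝ) - (m : ℝ) / 2) := by
    refine ⟨Nat.find_spec hex, ?_⟩
    rintro x ⟨n, G, hG, hm, rfl⟩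
    have h1 : Nat.find hex ≤ maxCut G := by
      apply Nat.find_min'
      exact ⟨n, G, hG, hm, by simp [surplus, hm]⟩
    have h2 : (Nat.find hex : ℝ) ≤ (maxCut G : ℝ) := by exact_mod_cast h1
    simp only [surplus, hm]
    linarith
  unfold sp
  rw [hl.csInf_eq]
  exact hl

/-- The wheel with `n` spokes: the hub `none` is joined to every vertex `some i` of the cycle
`C_n`. -/
def wheel (n : ℕ) : SimpleGraph (Option (Fin n)) where
  Adj
    | none, none => False
    | none, some _ => True
    | some _, none => True
    | some i, some j => (SimpleGraph.cycleGraph n).Adj i j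
  symm.symm
    | none, none => id
    | none, some _ => id
    | some _, none => id
    | some _, some _ => fun h => h.symm
  loopless.irrefl
    | none => id
    | some _ => (SimpleGraph.cycleGraph n).irrefl

end MaxCutSurplus

namespace MaxCutSurplus

/-! The surplus is the maximum over sign vectors of -1/4 times the adjacency quadratic form, and
multilinearity lets vectors with entries in [-1, 1] compete as well.

Lower bound. In a wheel-free graph a neighbourhood on s vertices spans O(k s^{3/2}) edges
(`sum_adjInd_le_of_wheel_free`): k of its vertices with pairwise at least 2k common neighbours
inside it would interlace into a rim, and a double count of the remaining pairs bounds the sum of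
squared degrees. Surplus is then produced by Gaussian rounding (`surplus_ge_of_vectors`): place
vectors of norm at most 1 on the vertices and take sines of Gaussian projections; negative inner
products along edges gain, positive ones lose. Let D be of order m^{2/5}. Either some vertex set
induces minimum degree at least D, and centred normalised neighbourhood vectors give surplus of
order D^2; or the graph has an orientation with out-degrees at most D, and perturbing a multiple of
each basis vector against its out-neighbourhood gives order m/√D. Sparse neighbourhoods control the
positive inner products. Both quantities have order m^{4/5}.

Upper bound. A geometry over a field of order q has q^3 points, q^3 lines, q points per line and no
triangles. Split each line into two classes by signs and join the classes completely. The graph is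
triangle-free, hence wheel-free. Suitable signs (`exists_signs`) make every cut gain only O(q) per
line on average, so the surplus is O(q^4) with order q^5 edges. Discarding lines and a few edges
reaches every m. -/

/-! ### Cuts and the adjacency quadratic form. -/

/-- The indicator of adjacency, with values in the reals. -/
noncomputable def adjInd {V : Type*} (G : SimpleGraph V) (u v : V) : ℝ :=
  open Classical in if G.Adj u v then 1 else 0

section adjInd
variable {V : Type*} {G : SimpleGraph V} {u v : V}

theorem adjInd_of_adj (h : G.Adj u v) : adjInd G u v = 1 := by simp [adjInd, h]

theorem adjInd_of_not_adj (h : ¬ G.Adj u v) : adjInd G u v = 0 := by simp [adjInd, h]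

theorem adjInd_self : adjInd G u u = 0 := adjInd_of_not_adj G.irrefl

theorem adjInd_comm : adjInd G u v = adjInd G v u := by
  by_cases h : G.Adj u v
  · rw [adjInd_of_adj h, adjInd_of_adj h.symm]
  · rw [adjInd_of_not_adj h, adjInd_of_not_adj fun h' => h h'.symm]

theorem adjInd_nonneg : 0 ≤ adjInd G u v := by unfold adjInd; split_ifs <;> norm_num

theorem adjInd_le_one : adjInd G u v ≤ 1 := by unfold adjInd; split_ifs <;> norm_num

end adjInd

/-- The quadratic form of the adjacency matrix of `G`. -/
noncomputable def quadForm {V : Type*} [Fintype V] (G : SimpleGraph V) (f : V → ℝ) : ℝ :=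
  ∑ u, ∑ v, adjInd G u v * (f u * f v)

theorem sum_adjInd {V : Type*} [Fintype V] (G : SimpleGraph V) :
    ∑ u, ∑ v, adjInd G u v = 2 * (G.edgeSet.ncard : ℝ) := by
  classical
  have h := G.sum_degrees_eq_twice_card_edges
  rw [← Set.ncard_coe_finset, SimpleGraph.coe_edgeFinset] at h
  have h2 : ((∑ v, G.degree v : ℕ) : ℝ) = 2 * (G.edgeSet.ncard : ℝ) := by
    rw [h]; push_cast; ring
  rw [← h2, Nat.cast_sum]
  refine Finset.sum_congr rfl fun u _ => ?_
  rw [← SimpleGraph.card_neighborFinset_eq_degree, SimpleGraph.neighborFinset_eq_filter]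
  simp [adjInd]

/-- The vector of signs associated with a vertex set. -/
noncomputable def signOf {V : Type*} (s : Finset V) (v : V) : ℝ :=
  open Classical in if v ∈ s then 1 else -1

/-- A pair with signs x, y is separated exactly when xy = -1, so (1 - xy)/2 indicates separation;
ordered pairs count each edge twice. -/
theorem cut_ncard_eq {V : Type*} [Fintype V] (G : SimpleGraph V) (s : Finset V) :
    ((G.between (s : Set V) (s : Set V)ᶜ).edgeSet.ncard : ℝ) =
      (G.edgeSet.ncard : ℝ) / 2 - quadForm G (signOf s) / 4 := by
  classical
  have h1 := sum_adjInd G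
  have h2 := sum_adjInd (G.between (s : Set V) (s : Set V)ᶜ)
  have h3 : ∑ u, ∑ v, adjInd (G.between (s : Set V) (s : Set V)ᶜ) u v
      = (∑ u, ∑ v, adjInd G u v - quadForm G (signOf s)) / 2 := by
    rw [quadForm, ← Finset.sum_sub_distrib, Finset.sum_div]
    refine Finset.sum_congr rfl fun u _ => ?_
    rw [← Finset.sum_sub_distrib, Finset.sum_div]
    refine Finset.sum_congr rfl fun v _ => ?_
    unfold adjInd signOf
    by_cases hG : G.Adj u v <;> by_cases hu : u ∈ s <;> by_cases hv : v ∈ s <;>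
      simp [SimpleGraph.between_adj, hG, hu, hv]
  linarith

theorem neg_quadForm_signOf_le_surplus {V : Type*} [Fintype V] (G : SimpleGraph V)
    (s : Finset V) : -quadForm G (signOf s) / 4 ≤ surplus G := by
  have h : (G.between (s : Set V) (s : Set V)ᶜ).edgeSet.ncard ≤ maxCut G :=
    Finset.le_sup (f := fun s : Finset V => (G.between (s : Set V) (s : Set V)ᶜ).edgeSet.ncard)
      (Finset.mem_univ s)
  have h' : ((G.between (s : Set V) (s : Set V)ᶜ).edgeSet.ncard : ℝ) ≤ maxCut G := by
    exact_mod_cast h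
  rw [cut_ncard_eq] at h'
  unfold surplus
  linarith

theorem exists_surplus_eq {V : Type*} [Fintype V] (G : SimpleGraph V) :
    ∃ s : Finset V, surplus G = -quadForm G (signOf s) / 4 := by
  obtain ⟨s, -, hs⟩ := Finset.exists_mem_eq_sup (Finset.univ : Finset (Finset V))
    Finset.univ_nonempty
    (fun s : Finset V => (G.between (s : Set V) (s : Set V)ᶜ).edgeSet.ncard)
  refine ⟨s, ?_⟩
  have h : (maxCut G : ℝ) = (G.between (s : Set V) (s : Set V)ᶜ).edgeSet.ncard := by
    exact_mod_cast hs
  rw [surplus, h, cut_ncard_eq]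
  ring

/-- The quadratic form of the adjacency matrix is affine in each coordinate. -/
theorem exists_quadForm_update {V : Type*} [Fintype V] [DecidableEq V] (G : SimpleGraph V)
    (f : V → ℝ) (w : V) :
    ∃ a b : ℝ, ∀ t : ℝ, quadForm G (Function.update f w t) = a + b * t := by
  refine ⟨∑ u ∈ Finset.univ.erase w, ∑ v ∈ Finset.univ.erase w, adjInd G u v * (f u * f v),
    2 * ∑ v ∈ Finset.univ.erase w, adjInd G w v * f v, fun t => ?_⟩
  have key : ∀ u, ∑ v, adjInd G u v *
      (Function.update f w t u * Function.update f w t v) =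
      adjInd G u w * (Function.update f w t u * t) +
        ∑ v ∈ Finset.univ.erase w, adjInd G u v * (Function.update f w t u * f v) := by
    intro u
    rw [← Finset.add_sum_erase _ _ (Finset.mem_univ w)]
    congr 1
    · simp
    · refine Finset.sum_congr rfl fun v hv => ?_
      rw [Function.update_of_ne (Finset.ne_of_mem_erase hv)]
  unfold quadForm
  simp_rw [key]
  rw [← Finset.add_sum_erase _ _ (Finset.mem_univ w)]
  have h2 : ∀ u ∈ Finset.univ.erase w, adjInd G u w * (Function.update f w t u * t) +
        ∑ v ∈ Finset.univ.erase w, adjInd G u v * (Function.update f w t u * f v) =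
      adjInd G w u * f u * t + ∑ v ∈ Finset.univ.erase w, adjInd G u v * (f u * f v) := by
    intro u hu
    rw [Function.update_of_ne (Finset.ne_of_mem_erase hu), adjInd_comm]
    ring
  rw [Finset.sum_congr rfl h2, Finset.sum_add_distrib, ← Finset.sum_mul, adjInd_self,
    Function.update_self]
  have h3 : ∑ v ∈ Finset.univ.erase w, adjInd G w v * (t * f v) =
      (∑ v ∈ Finset.univ.erase w, adjInd G w v * f v) * t := by
    rw [Finset.sum_mul]
    exact Finset.sum_congr rfl fun v _ => by ring
  rw [h3]
  ring

/-- Multilinear rounding: fractional cuts are no better than cuts. -/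
theorem neg_quadForm_le_surplus {V : Type*} [Fintype V] (G : SimpleGraph V) (f : V → ℝ)
    (hf : ∀ v, |f v| ≤ 1) : -quadForm G f / 4 ≤ surplus G := by
  classical
  have key : ∀ S : Finset V, ∃ g : V → ℝ, (∀ v ∈ S, g v = 1 ∨ g v = -1) ∧
      (∀ v ∉ S, g v = f v) ∧ quadForm G g ≤ quadForm G f := by
    intro S
    induction S using Finset.induction_on with
    | empty => exact ⟨f, by simp, by simp, le_rfl⟩
    | insert w S hw ih =>
      obtain ⟨g, h1, h2, h3⟩ := ih
      obtain ⟨a, b, hab⟩ := exists_quadForm_update G g w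
      have hgw : quadForm G g = a + b * f w := by
        rw [← h2 w hw, ← hab, Function.update_eq_self]
      have hfw := abs_le.1 (hf w)
      -- An affine function on [-1, 1] is minimised at an endpoint.
      have : ∃ t : ℝ, (t = 1 ∨ t = -1) ∧ b * t ≤ b * f w := by
        rcases le_total 0 b with hb | hb
        · exact ⟨-1, Or.inr rfl, mul_le_mul_of_nonneg_left hfw.1 hb⟩
        · exact ⟨1, Or.inl rfl, mul_le_mul_of_nonpos_left hfw.2 hb⟩
      obtain ⟨t, ht, hbt⟩ := this
      refine ⟨Function.update g w t, fun v hv => ?_, fun v hv => ?_, ?_⟩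
      · by_cases hvw : v = w
        · subst hvw; simpa using ht
        · rw [Function.update_of_ne hvw]
          exact h1 v (Finset.mem_of_mem_insert_of_ne hv hvw)
      · rw [Finset.mem_insert, not_or] at hv
        rw [Function.update_of_ne hv.1]
        exact h2 v hv.2
      · rw [hab]
        linarith
  obtain ⟨g, h1, -, h3⟩ := key Finset.univ
  have hg : g = signOf (Finset.univ.filter fun v => g v = 1) := by
    funext v
    rcases h1 v (Finset.mem_univ v) with h | h
    · simp [signOf, h]
    · simp only [signOf, Finset.mem_filter, Finset.mem_univ, true_and, h]
      norm_num
  have := neg_quadForm_signOf_le_surplus G (Finset.univ.filter fun v => g v = 1)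
  rw [← hg] at this
  linarith

/-! ### Gaussian rounding. -/

open MeasureTheory ProbabilityTheory

theorem integral_cos_stdGaussian {ι : Type*} [Fintype ι] (z : EuclideanSpace ℝ ι) :
    ∫ g, Real.cos (inner ℝ g z) ∂(stdGaussian (EuclideanSpace ℝ ι)) =
      Real.exp (-‖z‖ ^ 2 / 2) := by
  have h := charFun_stdGaussian z
  rw [charFun_apply] at h
  have h2 := congrArg Complex.re h
  have hint : Integrable (fun g : EuclideanSpace ℝ ι => Complex.exp ((inner ℝ g z : ℝ) * Complex.I))
      (stdGaussian (EuclideanSpace ℝ ι)) := by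
    refine Integrable.of_bound (C := 1) (by fun_prop) (ae_of_all _ fun g => ?_)
    rw [Complex.norm_exp_ofReal_mul_I]
  have h3 := integral_re hint
  simp only [RCLike.re_eq_complex_re] at h3
  rw [← h3] at h2
  simp only [Complex.exp_ofReal_mul_I_re] at h2
  rw [h2, show (-(‖z‖ : ℂ) ^ 2 / 2) = ((-‖z‖ ^ 2 / 2 : ℝ) : ℂ) by push_cast; ring,
    Complex.exp_ofReal_re]

/-- The covariance of the sines of two Gaussian projections. -/
theorem integral_sin_mul_sin_stdGaussian {ι : Type*} [Fintype ι] (x y : EuclideanSpace ℝ ι) :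
    ∫ g, Real.sin (inner ℝ g x) * Real.sin (inner ℝ g y)
        ∂(stdGaussian (EuclideanSpace ℝ ι)) =
      Real.exp (-(‖x‖ ^ 2 + ‖y‖ ^ 2) / 2) * Real.sinh (inner ℝ x y) := by
  have hint : ∀ z : EuclideanSpace ℝ ι, Integrable (fun g => Real.cos (inner ℝ g z))
      (stdGaussian (EuclideanSpace ℝ ι)) := fun z =>
    Integrable.of_bound (C := 1) (by fun_prop) (ae_of_all _ fun g => Real.abs_cos_le_one _)
  have h : ∀ g : EuclideanSpace ℝ ι, Real.sin (inner ℝ g x) * Real.sin (inner ℝ g y) =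
      (Real.cos (inner ℝ g (x - y)) - Real.cos (inner ℝ g (x + y))) / 2 := by
    intro g
    rw [inner_sub_right, inner_add_right, Real.cos_sub, Real.cos_add]
    ring
  simp_rw [h]
  rw [integral_div, integral_sub (hint _) (hint _), integral_cos_stdGaussian,
    integral_cos_stdGaussian, norm_sub_sq_real, norm_add_sq_real, Real.sinh_eq]
  rw [mul_div_assoc', mul_sub, ← Real.exp_add, ← Real.exp_add]
  congr 3 <;> ring_nf

theorem sinh_le_two_mul {t : ℝ} (h0 : 0 ≤ t) (h1 : t ≤ 1) : Real.sinh t ≤ 2 * t := by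
  have h := Real.abs_exp_sub_one_le (x := t) (by rwa [abs_of_nonneg h0])
  have h' := Real.abs_exp_sub_one_le (x := -t) (by rwa [abs_neg, abs_of_nonneg h0])
  rw [abs_neg, abs_of_nonneg h0] at h'
  rw [abs_of_nonneg h0] at h
  rw [Real.sinh_eq]
  linarith [(abs_le.1 h).2, (abs_le.1 h').1]

/-- The pointwise estimate behind Gaussian rounding. -/
theorem exp_mul_sinh_le {r p q w : ℝ} (hw : Real.exp (-1) ≤ w) (hw' : w ≤ 1) (hp : 0 ≤ p)
    (hq : 0 ≤ q) (hr : p - q = r) (hr1 : |r| ≤ 1) :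
    w * Real.sinh r ≤ 2 * p - Real.exp (-1) * q := by
  have he : 0 < Real.exp (-1) := Real.exp_pos _
  have he1 : Real.exp (-1) ≤ 1 := by rw [Real.exp_le_one_iff]; norm_num
  have hr' := abs_le.1 hr1
  -- Positive inner products are inflated at most by the factor 2 of `sinh_le_two_mul`; negative
  -- ones keep at least the fraction exp(-1), the smallest possible weight.
  rcases le_total 0 r with h | h
  · have h1 := sinh_le_two_mul h hr'.2
    have h2 : w * Real.sinh r ≤ 1 * Real.sinh r :=
      mul_le_mul_of_nonneg_right hw' (Real.sinh_nonneg_iff.2 h)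
    nlinarith
  · have h1 : Real.sinh r ≤ r := Real.sinh_le_self_iff.2 h
    have h2 : w * Real.sinh r ≤ Real.exp (-1) * Real.sinh r :=
      mul_le_mul_of_nonpos_right hw (by linarith)
    have h3 := mul_le_mul_of_nonneg_left h1 he.le
    have h4 := mul_le_mul_of_nonneg_right he1 hp
    rw [← hr] at h3
    nlinarith

/-- Gaussian rounding: vectors of norm at most one whose inner products along edges are negative
on average yield surplus. -/
theorem surplus_ge_of_vectors {V ι : Type*} [Fintype V] [Fintype ι] (G : SimpleGraph V)
    (y : V → EuclideanSpace ℝ ι) (hy : ∀ v, ‖y v‖ ^ 2 ≤ 1) (p q : V → V → ℝ)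
    (hp : ∀ u v, 0 ≤ p u v) (hq : ∀ u v, 0 ≤ q u v)
    (hpq : ∀ u v, G.Adj u v → inner ℝ (y u) (y v) = p u v - q u v) :
    Real.exp (-1) * ∑ u, ∑ v, adjInd G u v * q u v - 2 * ∑ u, ∑ v, adjInd G u v * p u v ≤
      4 * surplus G := by
  have hint : ∀ u v, Integrable (fun g => adjInd G u v *
      (Real.sin (inner ℝ g (y u)) * Real.sin (inner ℝ g (y v))))
      (stdGaussian (EuclideanSpace ℝ ι)) := fun u v => by
    refine Integrable.const_mul ?_ _
    refine Integrable.of_bound (C := 1) (by fun_prop) (ae_of_all _ fun g => ?_)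
    rw [norm_mul]
    exact mul_le_one₀ (Real.abs_sin_le_one _) (norm_nonneg _) (Real.abs_sin_le_one _)
  have hle : ∫ g, -(4 * surplus G) ∂(stdGaussian (EuclideanSpace ℝ ι)) ≤
      ∫ g, quadForm G (fun v => Real.sin (inner ℝ g (y v)))
        ∂(stdGaussian (EuclideanSpace ℝ ι)) := by
    refine integral_mono (integrable_const _) ?_ fun g => ?_
    · exact integrable_finsetSum _ fun u _ => integrable_finsetSum _ fun v _ => hint u v
    · have := neg_quadForm_le_surplus G (fun v => Real.sin (inner ℝ g (y v)))
        fun v => Real.abs_sin_le_one _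
      simp only
      linarith
  rw [integral_const, probReal_univ, one_smul] at hle
  unfold quadForm at hle
  rw [integral_finsetSum _ fun u _ => integrable_finsetSum _ fun v _ => hint u v] at hle
  have hle2 : ∑ u, ∫ g, ∑ v, adjInd G u v *
      (Real.sin (inner ℝ g (y u)) * Real.sin (inner ℝ g (y v)))
        ∂(stdGaussian (EuclideanSpace ℝ ι)) ≤
      ∑ u, ∑ v, adjInd G u v * (2 * p u v - Real.exp (-1) * q u v) := by
    refine Finset.sum_le_sum fun u _ => ?_
    rw [integral_finsetSum _ fun v _ => hint u v]
    refine Finset.sum_le_sum fun v _ => ?_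
    rw [integral_const_mul, integral_sin_mul_sin_stdGaussian]
    by_cases h : G.Adj u v
    · refine mul_le_mul_of_nonneg_left ?_ adjInd_nonneg
      have hu := hy u
      have hv := hy v
      refine exp_mul_sinh_le ?_ ?_ (hp u v) (hq u v) (hpq u v h).symm ?_
      · exact Real.exp_le_exp.2 (by linarith)
      · rw [Real.exp_le_one_iff]
        linarith [sq_nonneg ‖y u‖, sq_nonneg ‖y v‖]
      · refine (abs_real_inner_le_norm _ _).trans ?_
        nlinarith [sq_nonneg (‖y u‖ - ‖y v‖)]
    · simp [adjInd_of_not_adj h]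
  have heq : ∑ u, ∑ v, adjInd G u v * (2 * p u v - Real.exp (-1) * q u v) =
      2 * ∑ u, ∑ v, adjInd G u v * p u v - Real.exp (-1) * ∑ u, ∑ v, adjInd G u v * q u v := by
    simp_rw [Finset.mul_sum]
    rw [← Finset.sum_sub_distrib]
    refine Finset.sum_congr rfl fun u _ => ?_
    rw [← Finset.sum_sub_distrib]
    exact Finset.sum_congr rfl fun v _ => by ring
  linarith

/-! ### Wheel-free graphs have sparse neighbourhoods. -/

theorem val_eq_of_val_sub_eq_one {n : ℕ} {i j : Fin n} (h : (j - i).val = 1) :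
    j.val = i.val + 1 ∨ (i.val + 1 = n ∧ j.val = 0) := by
  have hi := i.isLt
  have hj := j.isLt
  rw [Fin.sub_def] at h
  simp only at h
  rcases lt_or_ge j.val i.val with hlt | hge
  · rw [Nat.mod_eq_of_lt (by omega)] at h
    omega
  · rw [Nat.mod_eq_sub_mod (by omega), Nat.mod_eq_of_lt (by omega)] at h
    omega

/-- The cyclic successor on `Fin k`. -/
def cyclicSucc {k : ℕ} (a : Fin k) : Fin k :=
  ⟨(a.val + 1) % k, Nat.mod_lt _ (Nat.lt_of_le_of_lt (Nat.zero_le _) a.isLt)⟩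

theorem cyclicSucc_ne {k : ℕ} (hk : 2 ≤ k) (a : Fin k) : cyclicSucc a ≠ a := by
  intro h
  have h' : (a.val + 1) % k = a.val := congrArg Fin.val h
  have ha := a.isLt
  rcases Nat.lt_or_ge (a.val + 1) k with hlt | hge
  · rw [Nat.mod_eq_of_lt hlt] at h'
    omega
  · rw [show a.val + 1 = k by omega, Nat.mod_self] at h'
    omega

/-- A wheel is found from a hub, `k` rim vertices, and `k` further rim vertices interleaved. -/
theorem wheel_isContained_of_alternating {V : Type*} {G : SimpleGraph V} {k : ℕ}
    {h : V} {u w : Fin k → V} (hu : Function.Injective u) (hw : Function.Injective w)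
    (huw : ∀ i j, u i ≠ w j) (hhu : ∀ i, G.Adj h (u i)) (hhw : ∀ i, G.Adj h (w i))
    (h1 : ∀ i, G.Adj (u i) (w i)) (h2 : ∀ i, G.Adj (w i) (u (cyclicSucc i))) :
    (wheel (2 * k)).IsContained G := by
  let half : Fin (2 * k) → Fin k := fun i => ⟨i.val / 2, by omega⟩
  let f : Fin (2 * k) → V := fun i => if i.val % 2 = 0 then u (half i) else w (half i)
  have hhf : ∀ i, G.Adj h (f i) := by
    intro i
    by_cases hi : i.val % 2 = 0
    · simpa [f, hi] using hhu _
    · simpa [f, hi] using hhw _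
  have hf : Function.Injective f := by
    intro i j hij
    have hval : (half i).val = (half j).val → i.val % 2 = j.val % 2 → i = j := by
      intro ha hb
      simp only [half] at ha
      exact Fin.ext (by omega)
    by_cases hi : i.val % 2 = 0 <;> by_cases hj : j.val % 2 = 0 <;>
      simp only [f, hi, hj, if_true, if_false] at hij
    · exact hval (congrArg Fin.val (hu hij)) (by omega)
    · exact absurd hij (huw _ _)
    · exact absurd hij.symm (huw _ _)
    · exact hval (congrArg Fin.val (hw hij)) (by omega)
  have hstep : ∀ i j : Fin (2 * k), (j - i).val = 1 → G.Adj (f i) (f j) := by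
    intro i j hij
    have hji := val_eq_of_val_sub_eq_one hij
    have hi' := i.isLt
    by_cases hi : i.val % 2 = 0
    · have hj : j.val % 2 ≠ 0 := by omega
      have he : half j = half i := Fin.ext (by simp only [half]; omega)
      simp only [f, hi, hj, if_true, if_false, he]
      exact h1 _
    · have hj : j.val % 2 = 0 := by omega
      have he : half j = cyclicSucc (half i) := by
        refine Fin.ext ?_
        simp only [half, cyclicSucc]
        rcases hji with hji | ⟨hji, hj0⟩
        · have := j.isLt
          rw [Nat.mod_eq_of_lt (by omega)]
          omega
        · rw [show i.val / 2 + 1 = k by omega, Nat.mod_self, hj0]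
      simp only [f, hi, hj, if_true, if_false, he]
      exact h2 _
  refine ⟨⟨⟨fun o => o.elim h f, ?_⟩, ?_⟩⟩
  · intro a b hab
    match a, b, hab with
    | none, some i, _ => exact hhf i
    | some i, none, _ => exact (hhf i).symm
    | some i, some j, hab =>
      rcases SimpleGraph.cycleGraph_adj'.1 hab with h' | h'
      · exact (hstep j i h').symm
      · exact hstep i j h'
  · intro a b hab
    match a, b, hab with
    | none, none, _ => rfl
    | none, some i, hab => exact absurd hab (hhf i).ne
    | some i, none, hab => exact absurd hab.symm (hhf i).ne
    | some i, some j, hab => exact congrArg some (hf hab)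

/-- If `k` vertices in the neighbourhood of `h` have pairwise many common neighbours there, then
`h` is the hub of a wheel. -/
theorem wheel_isContained_of_commonNeighbors {V : Type*} [DecidableEq V] {G : SimpleGraph V}
    [DecidableRel G.Adj] {k : ℕ} (hk : 2 ≤ k) {h : V} {S T : Finset V}
    (hS : ∀ v ∈ S, G.Adj h v) (hTS : T ⊆ S) (hT : k ≤ T.card)
    (hcod : ∀ a ∈ T, ∀ b ∈ T, a ≠ b →
      2 * k ≤ (S.filter fun v => G.Adj v a ∧ G.Adj v b).card) :
    (wheel (2 * k)).IsContained G := by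
  obtain ⟨T', hT'T, hT'k⟩ := Finset.exists_subset_card_eq hT
  let e := T'.equivFinOfCardEq hT'k
  let u : Fin k → V := fun i => (e.symm i).val
  have hu : Function.Injective u := fun i j hij => e.symm.injective (Subtype.ext hij)
  have huT' : ∀ i, u i ∈ T' := fun i => (e.symm i).property
  -- Candidates for the rim vertex between two consecutive chosen ones. Removing the k chosen
  -- vertices from at least 2k leaves at least k candidates, so Hall's condition for k sets is
  -- automatic.
  let t : Fin k → Finset V := fun i =>
    (S.filter fun v => G.Adj v (u i) ∧ G.Adj v (u (cyclicSucc i))) \ T'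
  have ht : ∀ i, k ≤ (t i).card := by
    intro i
    have h1 := hcod _ (hT'T (huT' i)) _ (hT'T (huT' (cyclicSucc i)))
      fun he => cyclicSucc_ne hk i (hu he.symm)
    have h2 := Finset.le_card_sdiff T'
      (S.filter fun v => G.Adj v (u i) ∧ G.Adj v (u (cyclicSucc i)))
    simp only [t]
    omega
  obtain ⟨w, hw, hwt⟩ := (Finset.all_card_le_biUnion_card_iff_exists_injective t).1 (by
    intro s
    rcases s.eq_empty_or_nonempty with rfl | ⟨i, hi⟩
    · simp
    · calc s.card ≤ k := by simpa using s.card_le_univ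
        _ ≤ (t i).card := ht i
        _ ≤ _ := Finset.card_le_card (Finset.subset_biUnion_of_mem t hi))
  have hw' : ∀ i, (w i ∈ S ∧ G.Adj (w i) (u i) ∧ G.Adj (w i) (u (cyclicSucc i))) ∧ w i ∉ T' := by
    intro i
    have := hwt i
    simp only [t, Finset.mem_sdiff, Finset.mem_filter] at this
    exact this
  refine wheel_isContained_of_alternating (h := h) hu hw (fun i j he => (hw' j).2 (he ▸ huT' i))
    (fun i => hS _ (hTS (hT'T (huT' i)))) (fun i => hS _ (hw' i).1.1)
    (fun i => (hw' i).1.2.1.symm) fun i => (hw' i).1.2.2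

/-- In a wheel-free graph, neighbourhoods span few edges. -/
theorem sum_adjInd_le_of_wheel_free {V : Type*} {G : SimpleGraph V} {k : ℕ}
    (hk : 2 ≤ k) (hG : (wheel (2 * k)).Free G) {h : V} {S : Finset V}
    (hS : ∀ v ∈ S, G.Adj h v) :
    ∑ u ∈ S, ∑ v ∈ S, adjInd G u v ≤ 3 * k * (S.card * √(S.card : ℝ)) := by
  classical
  let cod : V → V → ℕ := fun a b => (S.filter fun v => G.Adj v a ∧ G.Adj v b).card
  -- Marks the bad pairs: those with too few common neighbours to serve as consecutive chosen
  -- vertices.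
  let B : V → V → ℝ := fun a b => if a ≠ b ∧ cod a b < 2 * k then 1 else 0
  have hB0 : ∀ a b, 0 ≤ B a b := fun a b => by simp only [B]; split_ifs <;> norm_num
  have hAA : ∀ x y v, adjInd G v x * adjInd G v y =
      if G.Adj v x ∧ G.Adj v y then (1 : ℝ) else 0 := by
    intro x y v
    by_cases h1 : G.Adj v x <;> by_cases h2 : G.Adj v y <;> simp [adjInd, h1, h2]
  have hcod : ∀ a b, ∑ v ∈ S, adjInd G v a * adjInd G v b = cod a b := by
    intro a b
    simp_rw [hAA]
    rw [Finset.sum_boole]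
  have key : ∀ x y, (cod x y : ℝ) ≤ k + ∑ a ∈ S, ∑ b ∈ S,
      B a b * ((adjInd G a x * adjInd G a y) * (adjInd G b x * adjInd G b y)) := by
    intro x y
    let U := S.filter fun v => G.Adj v x ∧ G.Adj v y
    have hsum : ∑ a ∈ S, ∑ b ∈ S,
        B a b * ((adjInd G a x * adjInd G a y) * (adjInd G b x * adjInd G b y)) =
        ∑ a ∈ U, ∑ b ∈ U, B a b := by
      simp only [U, Finset.sum_filter, hAA]
      refine Finset.sum_congr rfl fun a _ => ?_
      by_cases ha : G.Adj a x ∧ G.Adj a y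
      · simp [ha]
      · simp [ha]
    let P : V → Prop := fun a => ∃ b ∈ U, a ≠ b ∧ cod a b < 2 * k
    -- Vertices of `U` without a bad partner in `U` form no bad pair among themselves, so k of them
    -- would yield a wheel. All others are charged to bad pairs inside `U`.
    have hT : (U.filter fun a => ¬ P a).card < k := by
      by_contra hcon
      refine hG (wheel_isContained_of_commonNeighbors hk hS
        ((Finset.filter_subset _ _).trans (Finset.filter_subset _ _)) (not_lt.1 hcon) ?_)
      intro a ha b hb hab
      by_contra hlt
      exact (Finset.mem_filter.1 ha).2 ⟨b, (Finset.mem_filter.1 hb).1, hab, not_le.1 hlt⟩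
    have hP : ((U.filter P).card : ℝ) ≤ ∑ a ∈ U, ∑ b ∈ U, B a b := by
      rw [Finset.card_filter, Nat.cast_sum]
      refine Finset.sum_le_sum fun a _ => ?_
      by_cases ha : P a
      · obtain ⟨b, hb, hab⟩ := ha
        have hB1 : B a b = 1 := by simp only [B, if_pos hab]
        have := Finset.single_le_sum (f := fun b => B a b) (fun b _ => hB0 a b) hb
        simp only [hB1] at this
        split_ifs <;> simp [this, Finset.sum_nonneg fun b _ => hB0 a b]
      · rw [if_neg ha, Nat.cast_zero]
        exact Finset.sum_nonneg fun b _ => hB0 a b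
    have hcard := Finset.card_filter_add_card_filter_not (s := U) P
    have hcard' : ((U.filter P).card : ℝ) + (U.filter fun a => ¬ P a).card = cod x y := by
      exact_mod_cast hcard
    have hT' : ((U.filter fun a => ¬ P a).card : ℝ) ≤ k := by exact_mod_cast hT.le
    rw [hsum]
    linarith
  -- Double count: a bad pair (a, b) lies in the common neighbourhood of (x, y) exactly when x and y
  -- are common neighbours of a and b, so it is counted `cod a b` squared times, less than (2k)^2.
  have hbad : ∑ x ∈ S, ∑ y ∈ S, ∑ a ∈ S, ∑ b ∈ S,
      B a b * ((adjInd G a x * adjInd G a y) * (adjInd G b x * adjInd G b y)) ≤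
      4 * k ^ 2 * (S.card : ℝ) ^ 2 := by
    have : ∑ x ∈ S, ∑ y ∈ S, ∑ a ∈ S, ∑ b ∈ S,
      B a b * ((adjInd G a x * adjInd G a y) * (adjInd G b x * adjInd G b y)) =
      ∑ a ∈ S, ∑ b ∈ S, B a b * (cod a b : ℝ) ^ 2 := by
      calc _ = ∑ x ∈ S, ∑ a ∈ S, ∑ b ∈ S, ∑ y ∈ S,
          B a b * ((adjInd G a x * adjInd G a y) * (adjInd G b x * adjInd G b y)) := by
            refine Finset.sum_congr rfl fun x _ => ?_
            rw [Finset.sum_comm]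
            exact Finset.sum_congr rfl fun a _ => Finset.sum_comm
        _ = ∑ a ∈ S, ∑ b ∈ S, ∑ x ∈ S, ∑ y ∈ S,
          B a b * ((adjInd G a x * adjInd G a y) * (adjInd G b x * adjInd G b y)) := by
            rw [Finset.sum_comm]
            exact Finset.sum_congr rfl fun a _ => Finset.sum_comm
        _ = _ := by
            refine Finset.sum_congr rfl fun a _ => Finset.sum_congr rfl fun b _ => ?_
            rw [← hcod, sq, Finset.sum_mul_sum, Finset.mul_sum]
            refine Finset.sum_congr rfl fun x _ => ?_
            rw [Finset.mul_sum]
            refine Finset.sum_congr rfl fun y _ => ?_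
            rw [adjInd_comm (u := a) (v := x), adjInd_comm (u := a) (v := y),
              adjInd_comm (u := b) (v := x), adjInd_comm (u := b) (v := y)]
            ring
    rw [this]
    calc _ ≤ ∑ a ∈ S, ∑ b ∈ S, (4 * k ^ 2 : ℝ) := by
          refine Finset.sum_le_sum fun a _ => Finset.sum_le_sum fun b _ => ?_
          simp only [B]
          split_ifs with hab
          · have : (cod a b : ℝ) ≤ 2 * k := by exact_mod_cast hab.2.le
            rw [one_mul]
            calc (cod a b : ℝ) ^ 2 ≤ (2 * k) ^ 2 := pow_le_pow_left₀ (Nat.cast_nonneg _) this 2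
              _ = _ := by ring
          · rw [zero_mul]; positivity
      _ = _ := by simp only [Finset.sum_const, nsmul_eq_mul]; ring
  have hsq : ∑ u ∈ S, (∑ v ∈ S, adjInd G u v) ^ 2 = ∑ x ∈ S, ∑ y ∈ S, (cod x y : ℝ) := by
    simp_rw [← hcod]
    calc _ = ∑ u ∈ S, ∑ x ∈ S, ∑ y ∈ S, adjInd G u x * adjInd G u y :=
          Finset.sum_congr rfl fun u _ => by rw [sq, Finset.sum_mul_sum]
      _ = _ := by
          rw [Finset.sum_comm]
          exact Finset.sum_congr rfl fun a _ => Finset.sum_comm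
  have hk1 : (1 : ℝ) ≤ k := by exact_mod_cast (by omega : 1 ≤ k)
  have h2 : ∑ x ∈ S, ∑ y ∈ S, (cod x y : ℝ) ≤ 9 * k ^ 2 * (S.card : ℝ) ^ 2 := by
    calc _ ≤ ∑ x ∈ S, ∑ y ∈ S, ((k : ℝ) + ∑ a ∈ S, ∑ b ∈ S,
        B a b * ((adjInd G a x * adjInd G a y) * (adjInd G b x * adjInd G b y))) :=
          Finset.sum_le_sum fun x _ => Finset.sum_le_sum fun y _ => key x y
      _ ≤ k * (S.card : ℝ) ^ 2 + 4 * k ^ 2 * (S.card : ℝ) ^ 2 := by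
          simp_rw [Finset.sum_add_distrib]
          refine add_le_add (le_of_eq ?_) hbad
          simp only [Finset.sum_const, nsmul_eq_mul]; ring
      _ = (k + 4 * k ^ 2) * (S.card : ℝ) ^ 2 := by ring
      _ ≤ _ := mul_le_mul_of_nonneg_right (by nlinarith) (sq_nonneg _)
  have hcs := sq_sum_le_card_mul_sum_sq (s := S) (f := fun u => ∑ v ∈ S, adjInd G u v)
  rw [hsq] at hcs
  refine (sq_le_sq₀ (Finset.sum_nonneg fun u _ => Finset.sum_nonneg fun v _ => adjInd_nonneg)
    (by positivity)).1 ?_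
  calc _ ≤ _ := hcs
    _ ≤ (S.card : ℝ) * (9 * k ^ 2 * (S.card : ℝ) ^ 2) :=
        mul_le_mul_of_nonneg_left h2 (Nat.cast_nonneg _)
    _ = _ := by
        rw [mul_pow, mul_pow, mul_pow, Real.sq_sqrt (Nat.cast_nonneg _)]
        ring

/-! ### Lower bound on the surplus from sparse neighbourhoods. -/

/-- Surplus from an orientation with bounded out-degrees in a graph with sparse neighbourhoods. -/
theorem surplus_ge_of_orientation {V : Type*} [Fintype V] (G : SimpleGraph V) {C D : ℝ}
    (hC : 1 ≤ C) (hD : 1 ≤ D)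
    (hsparse : ∀ (h : V) (S : Finset V), (∀ v ∈ S, G.Adj h v) →
      ∑ u ∈ S, ∑ v ∈ S, adjInd G u v ≤ C * (S.card * √(S.card : ℝ)))
    (out : V → Finset V) (hadj : ∀ u, ∀ v ∈ out u, G.Adj u v)
    (hcard : ∀ u, ((out u).card : ℝ) ≤ D)
    (hcover : ∀ u v, G.Adj u v → v ∈ out u ∨ u ∈ out v) :
    (G.edgeSet.ncard : ℝ) / √D / (288 * C) ≤ 4 * surplus G := by
  classical
  set m : ℝ := (G.edgeSet.ncard : ℝ) with hm
  have hm0 : 0 ≤ m := Nat.cast_nonneg _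
  let O : V → V → ℝ := fun u v => if v ∈ out u then 1 else 0
  have hO0 : ∀ u v, 0 ≤ O u v := fun u v => by simp only [O]; split_ifs <;> norm_num
  have hOA : ∀ u v, O u v ≤ adjInd G u v := by
    intro u v
    by_cases h : v ∈ out u
    · simp [O, h, adjInd_of_adj (hadj u v h)]
    · simp [O, h, adjInd_nonneg]
  have hAO : ∀ u v, adjInd G u v ≤ O u v + O v u := by
    intro u v
    by_cases h : G.Adj u v
    · rw [adjInd_of_adj h]
      rcases hcover u v h with h' | h'
      · have : O u v = 1 := by simp [O, h']
        linarith [hO0 v u]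
      · have : O v u = 1 := by simp [O, h']
        linarith [hO0 u v]
    · rw [adjInd_of_not_adj h]
      linarith [hO0 u v, hO0 v u]
  have hOself : ∀ v, O v v = 0 := fun v =>
    le_antisymm (by simpa [adjInd_self] using hOA v v) (hO0 v v)
  have hOsum : ∀ u, ∑ v, O u v = (out u).card := fun u => by simp [O]
  have hD0 : 0 < √D := Real.sqrt_pos.2 (by linarith)
  -- Chosen so that twice the positive part is at most bm/6, half of the gain bm/3 from the negative
  -- part.
  set β : ℝ := 1 / (48 * C) with hβ
  have hβ0 : 0 < β := by positivity
  have hβC : β * C = 1 / 48 := by rw [hβ]; field_simp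
  have hβ1 : β ≤ 1 / 48 := by nlinarith
  set b : ℝ := β / √D with hb
  have hb0 : 0 < b := by positivity
  have hbD : b ^ 2 * D = β ^ 2 := by rw [hb, div_pow, Real.sq_sqrt (by linarith)]; field_simp
  -- The cross terms give -b/2 for each oriented edge; the only positive contribution on an edge is
  -- b^2 times the number of common out-neighbours.
  let y : V → EuclideanSpace ℝ V := fun v =>
    WithLp.toLp 2 fun x => (if x = v then 1 / 2 else 0) - b * O v x
  have hinner : ∀ u v, inner ℝ (y u) (y v) =
      (if u = v then 1 / 4 else 0) + b ^ 2 * ∑ x, O u x * O v x - b / 2 * (O u v + O v u) := by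
    intro u v
    simp only [y, PiLp.inner_apply, RCLike.inner_apply, conj_trivial]
    have : ∀ x, ((if x = v then (1 / 2 : ℝ) else 0) - b * O v x) *
        ((if x = u then (1 / 2 : ℝ) else 0) - b * O u x) =
        (if x = v then (if v = u then (1 / 4 : ℝ) else 0) else 0) + b ^ 2 * (O u x * O v x)
        - (if x = v then b / 2 * O u v else 0) - (if x = u then b / 2 * O v u else 0) := by
      intro x
      by_cases h1 : x = v
      · by_cases h2 : x = u
        · have h3 : v = u := h1.symm.trans h2
          simp only [h1, h3, if_true]; ring
        · have h3 : ¬ v = u := fun h => h2 (h1.trans h)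
          simp only [h1, h3, if_true, if_false]; ring
      · by_cases h2 : x = u
        · simp only [h2, h2 ▸ h1, if_true, if_false]; ring
        · simp only [h1, h2, if_false]; ring
    simp_rw [this]
    rw [Finset.sum_sub_distrib, Finset.sum_sub_distrib, Finset.sum_add_distrib, ← Finset.mul_sum]
    simp only [Finset.sum_ite_eq', Finset.mem_univ, if_true, eq_comm (a := v) (b := u)]
    ring
  have hOsq : ∀ v, ∑ x, O v x * O v x = (out v).card := by
    intro v
    rw [← hOsum]
    exact Finset.sum_congr rfl fun x _ => by simp only [O]; split_ifs <;> norm_num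
  have hnorm : ∀ v, ‖y v‖ ^ 2 ≤ 1 := by
    intro v
    rw [← real_inner_self_eq_norm_sq, hinner, hOsq, if_pos rfl, hOself]
    have : b ^ 2 * (out v).card ≤ b ^ 2 * D := mul_le_mul_of_nonneg_left (hcard v) (sq_nonneg b)
    rw [hbD] at this
    nlinarith
  have hmain := surplus_ge_of_vectors G y hnorm (fun u v => b ^ 2 * ∑ x, O u x * O v x)
    (fun u v => b / 2 * (O u v + O v u))
    (fun u v => mul_nonneg (sq_nonneg b)
      (Finset.sum_nonneg fun x _ => mul_nonneg (hO0 u x) (hO0 v x)))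
    (fun u v => mul_nonneg (by positivity) (add_nonneg (hO0 u v) (hO0 v u)))
    (fun u v huv => by rw [hinner, if_neg huv.ne, zero_add])
  have hq : b * m ≤ ∑ u, ∑ v, adjInd G u v * (b / 2 * (O u v + O v u)) := by
    calc b * m = b / 2 * ∑ u, ∑ v, adjInd G u v := by rw [sum_adjInd]; ring
      _ = ∑ u, ∑ v, b / 2 * adjInd G u v := by simp_rw [Finset.mul_sum]
      _ ≤ _ := by
        refine Finset.sum_le_sum fun u _ => Finset.sum_le_sum fun v _ => ?_
        have h1 := hAO u v
        by_cases h : G.Adj u v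
        · rw [adjInd_of_adj h] at h1 ⊢
          nlinarith
        · simp [adjInd_of_not_adj h]
  -- A common out-neighbour x of u and v with u → v makes vx an edge inside the out-neighbourhood of
  -- u, which is sparse.
  have htri : ∀ u, ∑ v, ∑ x, O u v * (O u x * O v x) ≤ C * ((out u).card * √D) := by
    intro u
    calc ∑ v, ∑ x, O u v * (O u x * O v x) ≤ ∑ v ∈ out u, ∑ x ∈ out u, adjInd G v x := by
          rw [← Finset.sum_filter_add_sum_filter_not Finset.univ (fun v => v ∈ out u)]
          rw [Finset.sum_eq_zero (s := Finset.univ.filter fun v => v ∉ out u), add_zero,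
            Finset.filter_univ_mem]
          · refine Finset.sum_le_sum fun v hv => ?_
            rw [← Finset.sum_subset (Finset.subset_univ (out u))]
            · refine Finset.sum_le_sum fun x hx => ?_
              simpa [O, hv, hx] using hOA v x
            · intro x _ hx
              simp [O, hx]
          · intro v hv
            exact Finset.sum_eq_zero fun x _ => by simp [O, (Finset.mem_filter.1 hv).2]
      _ ≤ C * ((out u).card * √((out u).card : ℝ)) := hsparse u (out u) (hadj u)
      _ ≤ _ := by
        gcongr
        exact hcard u
  have hout : ∑ u, ((out u).card : ℝ) ≤ 2 * m := by
    rw [← sum_adjInd]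
    refine Finset.sum_le_sum fun u _ => ?_
    rw [← hOsum]
    exact Finset.sum_le_sum fun v _ => hOA u v
  have hp : ∑ u, ∑ v, adjInd G u v * (b ^ 2 * ∑ x, O u x * O v x) ≤
      4 * b ^ 2 * C * √D * m := by
    have h1 : ∑ u, ∑ v, adjInd G u v * (b ^ 2 * ∑ x, O u x * O v x) ≤
        ∑ u, ∑ v, (b ^ 2 * ∑ x, O u v * (O u x * O v x) +
          b ^ 2 * ∑ x, O v u * (O v x * O u x)) := by
      refine Finset.sum_le_sum fun u _ => Finset.sum_le_sum fun v _ => ?_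
      rw [← mul_add, ← Finset.sum_add_distrib, mul_left_comm, Finset.mul_sum]
      refine mul_le_mul_of_nonneg_left (Finset.sum_le_sum fun x _ => ?_) (sq_nonneg b)
      have := mul_le_mul_of_nonneg_right (hAO u v) (mul_nonneg (hO0 u x) (hO0 v x))
      linarith
    have h2 : ∑ u, ∑ v, (b ^ 2 * ∑ x, O u v * (O u x * O v x) +
          b ^ 2 * ∑ x, O v u * (O v x * O u x)) =
        2 * b ^ 2 * ∑ u, ∑ v, ∑ x, O u v * (O u x * O v x) := by
      simp_rw [Finset.sum_add_distrib]
      rw [Finset.sum_comm (f := fun u v => b ^ 2 * ∑ x, O v u * (O v x * O u x))]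
      simp_rw [← Finset.mul_sum]
      ring
    rw [h2] at h1
    refine h1.trans ?_
    calc 2 * b ^ 2 * ∑ u, ∑ v, ∑ x, O u v * (O u x * O v x)
        ≤ 2 * b ^ 2 * ∑ u, C * ((out u).card * √D) := by
          refine mul_le_mul_of_nonneg_left (Finset.sum_le_sum fun u _ => htri u) (by positivity)
      _ = 2 * b ^ 2 * C * √D * ∑ u, ((out u).card : ℝ) := by
          rw [← Finset.mul_sum, ← Finset.sum_mul]; ring
      _ ≤ 2 * b ^ 2 * C * √D * (2 * m) := mul_le_mul_of_nonneg_left hout (by positivity)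
      _ = _ := by ring
  have he : (1 / 3 : ℝ) ≤ Real.exp (-1) := by
    rw [Real.exp_neg, ← one_div]
    exact one_div_le_one_div_of_le (Real.exp_pos _) Real.exp_one_lt_three.le
  have h1 : (1 / 3 : ℝ) * (b * m) ≤
      Real.exp (-1) * ∑ u, ∑ v, adjInd G u v * (b / 2 * (O u v + O v u)) :=
    mul_le_mul he hq (by positivity) (Real.exp_pos _).le
  have h2 : 4 * b ^ 2 * C * √D * m = b * m / 12 := by
    have : b * √D = β := by rw [hb]; field_simp
    calc _ = 4 * (b * √D) * C * (b * m) := by ring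
      _ = 4 * (β * C) * (b * m) := by rw [this]; ring
      _ = _ := by rw [hβC]; ring
  have h3 : m / √D / (288 * C) = b * m / 6 := by rw [hb, hβ]; field_simp; ring
  rw [h3]
  rw [h2] at hp
  linarith

/-- Surplus from a subset inducing large minimum degree in a graph with sparse neighbourhoods. -/
theorem surplus_ge_of_minDegree {V : Type*} [Fintype V] [DecidableEq V] (G : SimpleGraph V)
    [DecidableRel G.Adj] {C D : ℝ} (hC : 0 ≤ C) (hD : 0 < D)
    (hsparse : ∀ (h : V) (S : Finset V), (∀ v ∈ S, G.Adj h v) →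
      ∑ u ∈ S, ∑ v ∈ S, adjInd G u v ≤ C * (S.card * √(S.card : ℝ)))
    {U : Finset V} (hU : U.Nonempty)
    (hdeg : ∀ v ∈ U, D ≤ ((U.filter (G.Adj v)).card : ℝ)) :
    D ^ 2 / 3 - 4 * C * (G.edgeSet.ncard : ℝ) / √D ≤ 4 * surplus G := by
  let α : V → V → ℝ := fun u v => if u ∈ U ∧ v ∈ U ∧ G.Adj u v then 1 else 0
  let d : V → ℝ := fun u => ∑ v, α u v
  set N : ℝ := (U.card : ℝ) with hN
  have hN0 : 0 < N := by rw [hN]; exact_mod_cast hU.card_pos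
  have hα0 : ∀ u v, 0 ≤ α u v := fun u v => by simp only [α]; split_ifs <;> norm_num
  have hαA : ∀ u v, α u v ≤ adjInd G u v := by
    intro u v
    by_cases h : G.Adj u v
    · rw [adjInd_of_adj h]; simp only [α]; split_ifs <;> norm_num
    · simp [adjInd_of_not_adj h, α, h]
  have hd0 : ∀ u, 0 ≤ d u := fun u => Finset.sum_nonneg fun v _ => hα0 u v
  have hdU : ∀ u ∈ U, d u = (U.filter (G.Adj u)).card := by
    intro u hu
    simp only [d, α, hu, true_and, Finset.sum_boole]
    congr 2
    ext v
    simp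
  have hdD : ∀ u ∈ U, D ≤ d u := fun u hu => by rw [hdU u hu]; exact hdeg u hu
  have hdU' : ∀ u ∉ U, d u = 0 := fun u hu => by simp [d, α, hu]
  have hdsum : ∑ u, d u ≤ 2 * (G.edgeSet.ncard : ℝ) := by
    rw [← sum_adjInd]
    exact Finset.sum_le_sum fun u _ => Finset.sum_le_sum fun v _ => hαA u v
  -- The normalised neighbourhood vector within `U`, minus its projection onto the indicator of `U`.
  -- For v outside `U` it is zero, since division by zero gives zero.
  let y : V → EuclideanSpace ℝ V := fun v =>
    WithLp.toLp 2 fun x => α v x / √(d v) - √(d v) / N * (if x ∈ U then 1 else 0)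
  have hαU : ∀ v x, α v x * (if x ∈ U then 1 else 0) = α v x := by
    intro v x
    by_cases h : x ∈ U <;> simp [α, h]
  have hinner : ∀ u v, inner ℝ (y u) (y v) =
      (∑ x, α u x * α v x) * ((√(d u))⁻¹ * (√(d v))⁻¹) - √(d u) * √(d v) / N := by
    intro u v
    simp only [y, PiLp.inner_apply, RCLike.inner_apply, conj_trivial]
    have : ∀ x, (α v x / √(d v) - √(d v) / N * (if x ∈ U then 1 else 0)) *
        (α u x / √(d u) - √(d u) / N * (if x ∈ U then 1 else 0)) =
        α u x * α v x * ((√(d u))⁻¹ * (√(d v))⁻¹) - α v x * (√(d u) / N / √(d v)) -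
          α u x * (√(d v) / N / √(d u)) +
          (if x ∈ U then 1 else 0) * (√(d u) * √(d v) / N ^ 2) := by
      intro x
      rw [← hαU u x, ← hαU v x]
      by_cases h : x ∈ U
      · simp only [h, if_true]; ring
      · simp [h]
    simp_rw [this]
    rw [Finset.sum_add_distrib, Finset.sum_sub_distrib, Finset.sum_sub_distrib,
      ← Finset.sum_mul, ← Finset.sum_mul, ← Finset.sum_mul, ← Finset.sum_mul]
    have h1 : (∑ x, α v x) * (√(d u) / N / √(d v)) = √(d u) * √(d v) / N := by
      change d v * _ = _
      calc _ = √(d u) / N * (d v / √(d v)) := by ring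
        _ = _ := by rw [Real.div_sqrt]; ring
    have h2 : (∑ x, α u x) * (√(d v) / N / √(d u)) = √(d u) * √(d v) / N := by
      change d u * _ = _
      calc _ = √(d v) / N * (d u / √(d u)) := by ring
        _ = _ := by rw [Real.div_sqrt]; ring
    have h3 : (∑ x, if x ∈ U then (1 : ℝ) else 0) = N := by simp [hN]
    rw [h1, h2, h3]
    field_simp
    ring
  have hnorm : ∀ v, ‖y v‖ ^ 2 ≤ 1 := by
    intro v
    rw [← real_inner_self_eq_norm_sq, hinner]
    have h1 : ∑ x, α v x * α v x = d v :=
      Finset.sum_congr rfl fun x _ => by simp only [α]; split_ifs <;> norm_num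
    have h2 : d v * ((√(d v))⁻¹ * (√(d v))⁻¹) ≤ 1 := by
      rw [← mul_inv, Real.mul_self_sqrt (hd0 v)]
      exact mul_inv_le_one
    have h3 : 0 ≤ √(d v) * √(d v) / N := by positivity
    rw [h1]
    linarith
  have hmain := surplus_ge_of_vectors G y hnorm
    (fun u v => (∑ x, α u x * α v x) * ((√(d u))⁻¹ * (√(d v))⁻¹))
    (fun u v => √(d u) * √(d v) / N)
    (fun u v => mul_nonneg (Finset.sum_nonneg fun x _ => mul_nonneg (hα0 u x) (hα0 v x))
      (by positivity))
    (fun u v => by positivity) (fun u v _ => hinner u v)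
  -- `U` spans at least ND ordered adjacent pairs, each contributing at least D/N.
  have hq : D ^ 2 ≤ ∑ u, ∑ v, adjInd G u v * (√(d u) * √(d v) / N) := by
    have h1 : ∑ u, ∑ v, α u v * (D / N) ≤ ∑ u, ∑ v, adjInd G u v * (√(d u) * √(d v) / N) := by
      refine Finset.sum_le_sum fun u _ => Finset.sum_le_sum fun v _ => ?_
      by_cases h : u ∈ U ∧ v ∈ U ∧ G.Adj u v
      · have h2 : D ≤ √(d u) * √(d v) := by
          rw [← Real.mul_self_sqrt hD.le]
          exact mul_le_mul (Real.sqrt_le_sqrt (hdD u h.1)) (Real.sqrt_le_sqrt (hdD v h.2.1))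
            (Real.sqrt_nonneg _) (Real.sqrt_nonneg _)
        refine mul_le_mul (hαA u v) ?_ (by positivity) adjInd_nonneg
        gcongr
      · have : α u v = 0 := by simp only [α, if_neg h]
        rw [this, zero_mul]
        exact mul_nonneg adjInd_nonneg (by positivity)
    refine le_trans ?_ h1
    simp_rw [← Finset.sum_mul]
    have h2 : N * D ≤ ∑ u, d u := by
      calc N * D = ∑ u ∈ U, D := by rw [Finset.sum_const, nsmul_eq_mul]
        _ ≤ ∑ u ∈ U, d u := Finset.sum_le_sum hdD
        _ ≤ _ := Finset.sum_le_univ_sum_of_nonneg hd0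
    calc D ^ 2 = N * D * (D / N) := by field_simp
      _ ≤ _ := mul_le_mul_of_nonneg_right h2 (by positivity)
  have htri : ∀ u, ∑ v, ∑ x, adjInd G u v * (α u x * α v x) ≤ C * (d u * √(d u)) := by
    intro u
    by_cases hu : u ∈ U
    · rw [hdU u hu]
      refine le_trans ?_ (hsparse u (U.filter (G.Adj u)) fun v hv => (Finset.mem_filter.1 hv).2)
      have hzero : ∀ v x, v ∉ U.filter (G.Adj u) ∨ x ∉ U.filter (G.Adj u) →
          adjInd G u v * (α u x * α v x) = 0 := by
        intro v x h
        by_cases h1 : G.Adj u v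
        · by_cases h2 : v ∈ U
          · have : x ∉ U.filter (G.Adj u) :=
              h.resolve_left (not_not_intro (Finset.mem_filter.2 ⟨h2, h1⟩))
            have h3 : ¬ (u ∈ U ∧ x ∈ U ∧ G.Adj u x) := fun h3 =>
              this (Finset.mem_filter.2 ⟨h3.2.1, h3.2.2⟩)
            simp only [α, if_neg h3, zero_mul, mul_zero]
          · simp [α, h2]
        · rw [adjInd_of_not_adj h1, zero_mul]
      rw [← Finset.sum_subset (Finset.subset_univ (U.filter (G.Adj u)))
        fun v _ hv => Finset.sum_eq_zero fun x _ => hzero v x (Or.inl hv)]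
      refine Finset.sum_le_sum fun v _ => ?_
      rw [← Finset.sum_subset (Finset.subset_univ (U.filter (G.Adj u)))
        fun x _ hx => hzero v x (Or.inr hx)]
      refine Finset.sum_le_sum fun x _ => ?_
      have h1 : α u x ≤ 1 := (hαA u x).trans adjInd_le_one
      have h2 : α u x * α v x ≤ 1 * adjInd G v x :=
        mul_le_mul h1 (hαA v x) (hα0 v x) zero_le_one
      have h3 := mul_le_mul (adjInd_le_one (G := G) (u := u) (v := v)) h2
        (mul_nonneg (hα0 u x) (hα0 v x)) zero_le_one
      linarith
    · have : ∀ x, α u x = 0 := fun x => by simp [α, hu]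
      simp [this, d]
  have hp : ∑ u, ∑ v, adjInd G u v * ((∑ x, α u x * α v x) * ((√(d u))⁻¹ * (√(d v))⁻¹)) ≤
      2 * C * (G.edgeSet.ncard : ℝ) / √D := by
    -- AM-GM splits 1/√(d u · d v) into one-vertex terms, so that each triangle count can be bounded
    -- in the neighbourhood of a single vertex.
    have h1 : ∑ u, ∑ v, adjInd G u v * ((∑ x, α u x * α v x) * ((√(d u))⁻¹ * (√(d v))⁻¹)) ≤
        ∑ u, ∑ v, ((d u)⁻¹ / 2 * ∑ x, adjInd G u v * (α u x * α v x) +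
          (d v)⁻¹ / 2 * ∑ x, adjInd G v u * (α v x * α u x)) := by
      refine Finset.sum_le_sum fun u _ => Finset.sum_le_sum fun v _ => ?_
      have h2 : ∑ x, adjInd G v u * (α v x * α u x) = ∑ x, adjInd G u v * (α u x * α v x) :=
        Finset.sum_congr rfl fun x _ => by rw [adjInd_comm]; ring
      rw [h2, ← add_mul, ← mul_assoc, Finset.mul_sum, mul_comm]
      refine mul_le_mul_of_nonneg_right ?_ (Finset.sum_nonneg fun x _ =>
        mul_nonneg adjInd_nonneg (mul_nonneg (hα0 u x) (hα0 v x)))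
      have hsu : (√(d u))⁻¹ ^ 2 = (d u)⁻¹ := by rw [inv_pow, Real.sq_sqrt (hd0 u)]
      have hsv : (√(d v))⁻¹ ^ 2 = (d v)⁻¹ := by rw [inv_pow, Real.sq_sqrt (hd0 v)]
      nlinarith [sq_nonneg ((√(d u))⁻¹ - (√(d v))⁻¹)]
    have h2 : ∑ u, ∑ v, ((d u)⁻¹ / 2 * ∑ x, adjInd G u v * (α u x * α v x) +
          (d v)⁻¹ / 2 * ∑ x, adjInd G v u * (α v x * α u x)) =
        ∑ u, (d u)⁻¹ * ∑ v, ∑ x, adjInd G u v * (α u x * α v x) := by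
      simp_rw [Finset.sum_add_distrib]
      rw [Finset.sum_comm
        (f := fun u v => (d v)⁻¹ / 2 * ∑ x, adjInd G v u * (α v x * α u x)),
        ← Finset.sum_add_distrib]
      refine Finset.sum_congr rfl fun u _ => ?_
      rw [← Finset.mul_sum]
      ring
    rw [h2] at h1
    refine h1.trans ?_
    have h3 : ∀ u, (d u)⁻¹ * ∑ v, ∑ x, adjInd G u v * (α u x * α v x) ≤ C / √D * d u := by
      intro u
      by_cases hu : u ∈ U
      · have hdu : 0 < d u := hD.trans_le (hdD u hu)
        calc _ ≤ (d u)⁻¹ * (C * (d u * √(d u))) :=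
              mul_le_mul_of_nonneg_left (htri u) (inv_nonneg.2 hdu.le)
          _ = C * √(d u) := by field_simp
          _ ≤ C * (d u / √D) := by
              refine mul_le_mul_of_nonneg_left ?_ hC
              rw [le_div_iff₀ (Real.sqrt_pos.2 hD)]
              calc √(d u) * √D ≤ √(d u) * √(d u) :=
                    mul_le_mul_of_nonneg_left (Real.sqrt_le_sqrt (hdD u hu)) (Real.sqrt_nonneg _)
                _ = d u := Real.mul_self_sqrt hdu.le
          _ = _ := by ring
      · simp [hdU' u hu]
    calc _ ≤ ∑ u, C / √D * d u := Finset.sum_le_sum fun u _ => h3 u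
      _ = C / √D * ∑ u, d u := by rw [← Finset.mul_sum]
      _ ≤ C / √D * (2 * (G.edgeSet.ncard : ℝ)) :=
          mul_le_mul_of_nonneg_left hdsum (by positivity)
      _ = _ := by ring
  have he : (1 / 3 : ℝ) ≤ Real.exp (-1) := by
    rw [Real.exp_neg, ← one_div]
    exact one_div_le_one_div_of_le (Real.exp_pos _) Real.exp_one_lt_three.le
  have h1 : (1 / 3 : ℝ) * D ^ 2 ≤
      Real.exp (-1) * ∑ u, ∑ v, adjInd G u v * (√(d u) * √(d v) / N) :=
    mul_le_mul he hq (by positivity) (Real.exp_pos _).le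
  have h4 : 2 * (2 * C * (G.edgeSet.ncard : ℝ) / √D) = 4 * C * (G.edgeSet.ncard : ℝ) / √D := by
    ring
  linarith

/-- Either some vertex set induces large minimum degree, or there is an orientation with small
out-degrees. -/
theorem exists_minDegree_or_orientation {V : Type*} [DecidableEq V] (G : SimpleGraph V)
    [DecidableRel G.Adj] {D : ℝ} (hD : 0 ≤ D) (U : Finset V) :
    (∃ W : Finset V, W.Nonempty ∧ ∀ v ∈ W, D ≤ ((W.filter (G.Adj v)).card : ℝ)) ∨
      ∃ out : V → Finset V, (∀ u, ∀ v ∈ out u, G.Adj u v) ∧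
        (∀ u, ((out u).card : ℝ) ≤ D) ∧
        ∀ u ∈ U, ∀ v ∈ U, G.Adj u v → v ∈ out u ∨ u ∈ out v := by
  induction U using Finset.strongInduction with
  | H U ih =>
    rcases U.eq_empty_or_nonempty with rfl | hU
    · exact Or.inr ⟨fun _ => ∅, by simp, fun _ => by simpa using hD, by simp⟩
    · by_cases hmin : ∀ v ∈ U, D ≤ ((U.filter (G.Adj v)).card : ℝ)
      · exact Or.inl ⟨U, hU, hmin⟩
      · push Not at hmin
        obtain ⟨w, hw, hwD⟩ := hmin
        rcases ih (U.erase w) (Finset.erase_ssubset hw) with h | ⟨out, h1, h2, h3⟩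
        · exact Or.inl h
        -- Peel off a vertex of small degree and direct its remaining edges away from it.
        · refine Or.inr ⟨Function.update out w (U.filter (G.Adj w)), ?_, ?_, ?_⟩
          · intro u v hv
            by_cases hu : u = w
            · subst hu
              rw [Function.update_self] at hv
              exact (Finset.mem_filter.1 hv).2
            · rw [Function.update_of_ne hu] at hv
              exact h1 u v hv
          · intro u
            by_cases hu : u = w
            · subst hu
              rw [Function.update_self]
              exact hwD.le
            · rw [Function.update_of_ne hu]
              exact h2 u
          · intro u hu v hv huv
            by_cases huw : u = w
            · subst huw
              left
              rw [Function.update_self]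
              exact Finset.mem_filter.2 ⟨hv, huv⟩
            · by_cases hvw : v = w
              · subst hvw
                right
                rw [Function.update_self]
                exact Finset.mem_filter.2 ⟨hu, huv.symm⟩
              · rw [Function.update_of_ne huw, Function.update_of_ne hvw]
                exact h3 u (Finset.mem_erase.2 ⟨huw, hu⟩) v (Finset.mem_erase.2 ⟨hvw, hv⟩) huv

theorem rpow_fifth_identities {m : ℝ} (hm : 1 ≤ m) :
    ∃ t : ℝ, 1 ≤ t ∧ m = t ^ 5 ∧ m ^ (4 / 5 : ℝ) = t ^ 4 := by
  have hm0 : 0 ≤ m := by linarith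
  refine ⟨m ^ (1 / 5 : ℝ), Real.one_le_rpow hm (by norm_num), ?_, ?_⟩
  · rw [← Real.rpow_natCast, ← Real.rpow_mul hm0]
    norm_num
  · rw [← Real.rpow_natCast, ← Real.rpow_mul hm0]
    norm_num

/-- The surplus of a graph with sparse neighbourhoods. -/
theorem surplus_ge_of_sparse_neighborhoods {V : Type*} [Fintype V] (G : SimpleGraph V) {C : ℝ}
    (hC : 1 ≤ C)
    (hsparse : ∀ (h : V) (S : Finset V), (∀ v ∈ S, G.Adj h v) →
      ∑ u ∈ S, ∑ v ∈ S, adjInd G u v ≤ C * (S.card * √(S.card : ℝ)))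
    (hm : 1 ≤ G.edgeSet.ncard) :
    1 / (4608 * C ^ 2) * (G.edgeSet.ncard : ℝ) ^ (4 / 5 : ℝ) ≤ surplus G := by
  classical
  obtain ⟨t, ht, hmt, hmt'⟩ := rpow_fifth_identities
    (m := (G.edgeSet.ncard : ℝ)) (by exact_mod_cast hm)
  have ht0 : 0 < t := by linarith
  -- The threshold is D = s^2 t^2 = 4C m^{2/5}, which balances D^2 against m/√D. The factor 4C lets
  -- D^2/3 absorb the loss 4Cm/√D, through 1 + 4C ≤ 16C^2/3 for C ≥ 1.
  set s : ℝ := √(4 * C) with hs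
  have hs2 : s ^ 2 = 4 * C := Real.sq_sqrt (by linarith)
  have hs0 : 0 ≤ s := Real.sqrt_nonneg _
  have hs1 : 1 ≤ s := by nlinarith
  have hsC : s ≤ 4 * C := by nlinarith
  have hD : 1 ≤ s ^ 2 * t ^ 2 := by
    rw [← mul_pow]
    exact one_le_pow₀ (one_le_mul_of_one_le_of_one_le hs1 ht)
  have hsD : √(s ^ 2 * t ^ 2) = s * t := by
    rw [← mul_pow]
    exact Real.sqrt_sq (by positivity)
  have hdiv : (G.edgeSet.ncard : ℝ) / (s * t) = t ^ 4 / s := by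
    rw [hmt]
    field_simp
  rw [hmt']
  have hfinal : t ^ 4 / s / (288 * C) ≤ 4 * surplus G := by
    rcases exists_minDegree_or_orientation G (D := s ^ 2 * t ^ 2) (by linarith) Finset.univ with
      ⟨W, hW, hWD⟩ | ⟨out, h1, h2, h3⟩
    · have := surplus_ge_of_minDegree G (C := C) (by linarith) (by linarith) hsparse hW hWD
      rw [hsD, mul_div_assoc, hdiv] at this
      refine le_trans ?_ this
      have h1 : t ^ 4 / s ≤ t ^ 4 := div_le_self (by positivity) hs1
      have h2 : t ^ 4 / s / (288 * C) ≤ t ^ 4 / s := div_le_self (by positivity) (by linarith)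
      have h3 : (s ^ 2 * t ^ 2) ^ 2 = 16 * C ^ 2 * t ^ 4 := by rw [hs2]; ring
      have h4 : 4 * C * (t ^ 4 / s) ≤ 4 * C * t ^ 4 :=
        mul_le_mul_of_nonneg_left h1 (by linarith)
      have h5 : (1 + 4 * C) * t ^ 4 ≤ 16 * C ^ 2 / 3 * t ^ 4 :=
        mul_le_mul_of_nonneg_right (by nlinarith) (by positivity)
      rw [h3]
      linarith
    · have := surplus_ge_of_orientation G hC hD hsparse out h1 h2
        fun u v => h3 u (Finset.mem_univ u) v (Finset.mem_univ v)
      rwa [hsD, hdiv] at this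
  have h6 : 1 / (4608 * C ^ 2) * t ^ 4 * 4 ≤ t ^ 4 / s / (288 * C) := by
    rw [div_div, le_div_iff₀ (by positivity)]
    have : 1 / (4608 * C ^ 2) * t ^ 4 * 4 * (s * (288 * C)) = t ^ 4 * (s / (4 * C)) := by
      field_simp
      norm_num
    rw [this]
    exact mul_le_of_le_one_right (by positivity) ((div_le_one (by linarith)).2 hsC)
  linarith

theorem surplus_ge_of_wheel_free {V : Type*} [Fintype V] {G : SimpleGraph V} {k : ℕ}
    (hk : 2 ≤ k) (hG : (wheel (2 * k)).Free G) (hm : 1 ≤ G.edgeSet.ncard) :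
    1 / (4608 * (3 * k) ^ 2) * (G.edgeSet.ncard : ℝ) ^ (4 / 5 : ℝ) ≤ surplus G := by
  have hk' : (2 : ℝ) ≤ k := by exact_mod_cast hk
  exact surplus_ge_of_sparse_neighborhoods G (by linarith)
    (fun h S hS => sum_adjInd_le_of_wheel_free hk hG hS) hm

/-! ### Signs with small line sums, by averaging. -/

/-- The sign of a Boolean. -/
def boolSign (b : Bool) : ℝ := if b then -1 else 1

theorem boolSign_xor (a b : Bool) : boolSign (a ^^ b) = boolSign a * boolSign b := by
  cases a <;> cases b <;> simp [boolSign]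

theorem boolSign_ne_indicator (a b : Bool) :
    (if a ≠ b then (1 : ℝ) else 0) = (1 - boolSign a * boolSign b) / 2 := by
  cases a <;> cases b <;> simp [boolSign]

theorem exp_neg_sq_mul_exp (c x : ℝ) :
    Real.exp (-x ^ 2) * Real.exp (x * (2 * c)) = Real.exp (c ^ 2) * Real.exp (-1 * (x - c) ^ 2) := by
  rw [← Real.exp_add, ← Real.exp_add]
  ring_nf

theorem integrable_exp_neg_sq_mul_exp (c : ℝ) :
    Integrable fun x : ℝ => Real.exp (-x ^ 2) * Real.exp (x * (2 * c)) := by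
  simp_rw [exp_neg_sq_mul_exp]
  exact ((integrable_exp_neg_mul_sq one_pos).comp_sub_right c).const_mul _

/-- Linearises the exponential of a square: exp(c^2) becomes a Gaussian average of exponentials
linear in c, which factor over independent signs. -/
theorem integral_exp_neg_sq_mul_exp (c : ℝ) :
    ∫ x : ℝ, Real.exp (-x ^ 2) * Real.exp (x * (2 * c)) = √Real.pi * Real.exp (c ^ 2) := by
  simp_rw [exp_neg_sq_mul_exp]
  rw [integral_const_mul, integral_sub_right_eq_self (fun x : ℝ => Real.exp (-1 * x ^ 2)),
    integral_gaussian, div_one, mul_comm]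

/-- The moment generating function of the square of a sum of independent signs. -/
theorem sum_exp_sq_sum_boolSign_le {ι : Type*} [Fintype ι] [DecidableEq ι] [Nonempty ι] :
    ∑ η : ι → Bool, Real.exp ((∑ i, boolSign (η i)) ^ 2 / (4 * Fintype.card ι)) ≤
      √2 * 2 ^ Fintype.card ι := by
  set N : ℕ := Fintype.card ι with hN
  have hN0 : (0 : ℝ) < N := by rw [hN]; exact_mod_cast Fintype.card_pos
  let c : (ι → Bool) → ℝ := fun η => (∑ i, boolSign (η i)) / (2 * √N)
  have hc : ∀ η, (∑ i, boolSign (η i)) ^ 2 / (4 * N) = c η ^ 2 := by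
    intro η
    simp only [c]
    rw [div_pow, mul_pow, Real.sq_sqrt hN0.le]
    norm_num
  have hpt : ∀ x : ℝ, ∑ η, Real.exp (-x ^ 2) * Real.exp (x * (2 * c η)) ≤
      2 ^ N * Real.exp (-(1 / 2) * x ^ 2) := by
    intro x
    have h1 : ∑ η, Real.exp (x * (2 * c η)) = (2 * Real.cosh (x / √N)) ^ N := by
      have h2 : ∀ η, Real.exp (x * (2 * c η)) = ∏ i, Real.exp (x / √N * boolSign (η i)) := by
        intro η
        rw [← Real.exp_sum, ← Finset.mul_sum]
        congr 1
        simp only [c]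
        field_simp
      simp_rw [h2]
      rw [← Fintype.piFinset_univ, ← Finset.prod_univ_sum (fun _ => Finset.univ)
        (fun _ b => Real.exp (x / √N * boolSign b)), Finset.prod_const, Finset.card_univ,
        Fintype.sum_bool, Real.cosh_eq]
      congr 1
      simp [boolSign]
      ring
    rw [← Finset.mul_sum, h1]
    calc Real.exp (-x ^ 2) * (2 * Real.cosh (x / √N)) ^ N
        ≤ Real.exp (-x ^ 2) * (2 * Real.exp ((x / √N) ^ 2 / 2)) ^ N := by
          gcongr
          exact Real.cosh_le_exp_half_sq _
      _ = _ := by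
          rw [mul_pow, ← Real.exp_nat_mul, div_pow, Real.sq_sqrt hN0.le, mul_left_comm,
            ← Real.exp_add]
          congr 2
          field_simp
          ring
  have hint : ∫ x : ℝ, ∑ η, Real.exp (-x ^ 2) * Real.exp (x * (2 * c η)) ≤
      ∫ x : ℝ, 2 ^ N * Real.exp (-(1 / 2) * x ^ 2) :=
    integral_mono (integrable_finsetSum _ fun η _ => integrable_exp_neg_sq_mul_exp (c η))
      ((integrable_exp_neg_mul_sq (by norm_num)).const_mul _) hpt
  rw [integral_finsetSum _ fun η _ => integrable_exp_neg_sq_mul_exp (c η), integral_const_mul,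
    integral_gaussian] at hint
  simp_rw [integral_exp_neg_sq_mul_exp] at hint
  rw [← Finset.mul_sum, show Real.pi / (1 / 2) = Real.pi * 2 by ring,
    Real.sqrt_mul Real.pi_pos.le] at hint
  simp_rw [hc]
  refine le_of_mul_le_mul_left (hint.trans_eq ?_) (Real.sqrt_pos.2 Real.pi_pos)
  ring

/-- Signs on the incidences of a configuration with as many lines as points, such that every
vector of signs on the points has a small image. -/
theorem exists_signs {X Λ ι : Type*} [Fintype X] [Fintype Λ] [Fintype ι] [Nonempty ι]
    (hcard : Fintype.card X = Fintype.card Λ) (pt : Λ → ι → X) :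
    ∃ ε : Λ → ι → Bool, ∀ x : X → Bool,
      ∑ l, (∑ a, boolSign (ε l a) * boolSign (x (pt l a))) ^ 2 ≤
        8 * Fintype.card ι * Fintype.card Λ := by
  classical
  set N : ℕ := Fintype.card ι with hN
  set M : ℕ := Fintype.card Λ with hM
  have hN0 : (0 : ℝ) < N := by rw [hN]; exact_mod_cast Fintype.card_pos
  let h : (ι → Bool) → ℝ := fun η => Real.exp ((∑ i, boolSign (η i)) ^ 2 / (4 * N))
  let E : (Λ → ι → Bool) → ℝ := fun ε => ∏ l, h (ε l)
  have hE : ∑ ε, E ε ≤ (√2 * 2 ^ N) ^ M := by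
    simp only [E]
    rw [← Fintype.piFinset_univ, ← Finset.prod_univ_sum (fun _ => Finset.univ) (fun _ η => h η),
      Finset.prod_const, Finset.card_univ]
    exact pow_le_pow_left₀ (Finset.sum_nonneg fun η _ => (Real.exp_pos _).le)
      sum_exp_sq_sum_boolSign_le _
  -- Multiplying the incidence signs by those of x permutes all choices of ε, so every x has the
  -- same average of `E` over ε.
  let tw : (X → Bool) → (Λ → ι → Bool) → (Λ → ι → Bool) := fun x ε l a => ε l a ^^ x (pt l a)
  have htw : ∀ x, Function.Involutive (tw x) := fun x ε => by
    funext l a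
    simp [tw]
  have hsum : ∑ ε, ∑ x, E (tw x ε) ≤ ∑ _ε : Λ → ι → Bool, (2 * √2) ^ M := by
    rw [Finset.sum_comm]
    calc ∑ x, ∑ ε, E (tw x ε) = ∑ _x : X → Bool, ∑ ε, E ε :=
          Finset.sum_congr rfl fun x _ => Equiv.sum_comp (htw x).toPerm E
      _ = 2 ^ M * ∑ ε, E ε := by
          rw [Finset.sum_const, Finset.card_univ, Fintype.card_fun, Fintype.card_bool, hcard,
            nsmul_eq_mul]
          push_cast
          rfl
      _ ≤ 2 ^ M * (√2 * 2 ^ N) ^ M := mul_le_mul_of_nonneg_left hE (by positivity)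
      _ = _ := by
          rw [Finset.sum_const, Finset.card_univ, Fintype.card_fun, Fintype.card_fun,
            Fintype.card_bool, nsmul_eq_mul]
          push_cast
          rw [← hN, ← hM]
          ring
  -- The sum over x includes all 2^M sign vectors, so one ε serves them simultaneously.
  obtain ⟨ε, -, hε⟩ := Finset.exists_le_of_sum_le Finset.univ_nonempty hsum
  refine ⟨ε, fun x => ?_⟩
  have h1 : E (tw x ε) ≤ (2 * √2) ^ M :=
    (Finset.single_le_sum (f := fun x => E (tw x ε))
      (fun x _ => Finset.prod_nonneg fun l _ => (Real.exp_pos _).le) (Finset.mem_univ x)).trans hε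
  have h2 : E (tw x ε) = Real.exp
      ((∑ l, (∑ a, boolSign (ε l a) * boolSign (x (pt l a))) ^ 2) / (4 * N)) := by
    simp only [E, h]
    rw [← Real.exp_sum, Finset.sum_div]
    simp only [tw, boolSign_xor]
  have h3 : 2 * √2 ≤ Real.exp 2 := by
    have : √2 ≤ 3 / 2 := Real.sqrt_le_iff.2 ⟨by norm_num, by norm_num⟩
    linarith [Real.add_one_le_exp (2 : ℝ)]
  have h4 : (2 * √2) ^ M ≤ Real.exp (M * 2) := by
    rw [Real.exp_nat_mul]
    exact pow_le_pow_left₀ (by positivity) h3 _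
  rw [h2] at h1
  have h5 := Real.exp_le_exp.1 (h1.trans h4)
  rw [div_le_iff₀ (by positivity)] at h5
  linarith

/-! ### A triangle-free geometry and its graph. -/

section Quadrangle
variable {F : Type*} [Field F]

/-- The point with first coordinate `a` on the line `l` of a point-line geometry without
triangles. -/
def quadranglePoint (l : F × F × F) (a : F) : F × F × F :=
  (a, a * l.1 - l.2.1, a * l.2.1 - l.2.2)

theorem quadranglePoint_line_unique {l l' : F × F × F} {a b a' b' : F} (hab : a ≠ b)
    (h1 : quadranglePoint l a = quadranglePoint l' a')
    (h2 : quadranglePoint l b = quadranglePoint l' b') : l = l' := by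
  obtain ⟨x, y, z⟩ := l
  obtain ⟨x', y', z'⟩ := l'
  simp only [quadranglePoint, Prod.mk.injEq] at h1 h2
  obtain ⟨rfl, h12, h13⟩ := h1
  obtain ⟨rfl, h22, h23⟩ := h2
  have hx : x = x' := mul_left_cancel₀ (sub_ne_zero.2 hab) (by linear_combination h12 - h22)
  subst hx
  have hy : y = y' := by linear_combination -h12
  subst hy
  have hz : z = z' := by linear_combination -h13
  subst hz
  rfl

theorem quadranglePoint_no_triangle {l l' l'' : F × F × F} {a b c a' b' c' : F} (hab : a ≠ b)
    (hbc : b ≠ c) (hac : a ≠ c) (h1 : quadranglePoint l a = quadranglePoint l'' a')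
    (h2 : quadranglePoint l b = quadranglePoint l' b')
    (h3 : quadranglePoint l' c = quadranglePoint l'' c') : l = l' ∧ l = l'' := by
  have hl : l = l'' := by
    obtain ⟨x, y, z⟩ := l
    obtain ⟨x', y', z'⟩ := l'
    obtain ⟨x'', y'', z''⟩ := l''
    simp only [quadranglePoint, Prod.mk.injEq] at h1 h2 h3
    obtain ⟨rfl, h12, h13⟩ := h1
    obtain ⟨rfl, h22, h23⟩ := h2
    obtain ⟨rfl, h32, h33⟩ := h3
    -- Around a triangle, both the first and the second line coordinates, weighted by the
    -- differences a - b, b - c, c - a, sum to zero. The incidences at two corners eliminate the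
    -- second line coordinates and x', leaving (a - b)(a - c)(x - x'') = 0.
    have hx : x = x'' := by
      refine mul_left_cancel₀ (mul_ne_zero (sub_ne_zero.2 hab) (sub_ne_zero.2 hac)) ?_
      linear_combination (h13 - h23 - h33) - (b - c) * h22 - (c - a) * h12 - b * (h12 - h22 - h32)
    subst hx
    have hy : y = y'' := by linear_combination -h12
    subst hy
    have hz : z = z'' := by linear_combination -h13
    subst hz
    rfl
  refine ⟨?_, hl⟩
  subst hl
  obtain rfl : c = c' := congrArg Prod.fst h3
  exact quadranglePoint_line_unique hbc h2 h3.symm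

/-- Two points of the geometry are adjacent when they lie on a common line of `L` and carry
different signs there. -/
def quadrangleGraph (L : Finset (F × F × F)) (ε : F × F × F → F → Bool) :
    SimpleGraph (F × F × F) where
  Adj u v := ∃ l ∈ L, ∃ a b, ε l a ≠ ε l b ∧ quadranglePoint l a = u ∧ quadranglePoint l b = v
  symm.symm := fun _ _ ⟨l, hl, a, b, hab, ha, hb⟩ => ⟨l, hl, b, a, hab.symm, hb, ha⟩
  loopless.irrefl := fun u ⟨l, _, a, b, hab, ha, hb⟩ => by
    have h : a = b := congrArg Prod.fst (ha.trans hb.symm)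
    exact hab (h ▸ rfl)

/-- A triangle would have to lie on a single line, where three points cannot carry pairwise
different signs. -/
theorem quadrangleGraph_no_triangle {L : Finset (F × F × F)} {ε : F × F × F → F → Bool}
    {u v w : F × F × F} (huv : (quadrangleGraph L ε).Adj u v) (hvw : (quadrangleGraph L ε).Adj v w)
    (huw : (quadrangleGraph L ε).Adj u w) : False := by
  obtain ⟨l, -, a, b, hab, rfl, rfl⟩ := huv
  obtain ⟨l', -, b', c, hbc, hb, rfl⟩ := hvw
  obtain ⟨l'', -, a', c', hac, ha, hc⟩ := huw
  obtain rfl : b' = b := congrArg Prod.fst hb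
  obtain rfl : a' = a := congrArg Prod.fst ha
  obtain rfl : c' = c := congrArg Prod.fst hc
  have hne : ∀ {l : F × F × F} {a b : F}, ε l a ≠ ε l b → a ≠ b := fun h he => h (he ▸ rfl)
  obtain ⟨rfl, rfl⟩ := quadranglePoint_no_triangle (hne hab) (hne hbc) (hne hac) ha.symm hb.symm
    hc.symm
  revert hab hbc hac
  cases ε l a' <;> cases ε l b' <;> cases ε l c' <;> simp

/-- The hub and two consecutive rim vertices form a triangle. -/
theorem wheel_free_of_no_triangle {V : Type*} {G : SimpleGraph V} {k : ℕ} (hk : 2 ≤ k)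
    (hG : ∀ u v w, G.Adj u v → G.Adj v w → G.Adj u w → False) : (wheel (2 * k)).Free G := by
  rintro ⟨φ⟩
  let i : Fin (2 * k) := ⟨0, by omega⟩
  let j : Fin (2 * k) := ⟨1, by omega⟩
  have hij : (SimpleGraph.cycleGraph (2 * k)).Adj i j := by
    rw [SimpleGraph.cycleGraph_adj']
    right
    rw [Fin.sub_val_of_le (by simp [i, j, Fin.le_def])]
    simp [i, j]
  exact hG (φ none) (φ (some i)) (φ (some j)) (φ.toHom.map_adj trivial)
    (φ.toHom.map_adj (v := some i) (w := some j) hij) (φ.toHom.map_adj trivial)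

/-- Two distinct points lie on at most one line, so the edge set is partitioned by the lines. -/
theorem sum_adjInd_quadrangleGraph [Fintype F] [DecidableEq F] (L : Finset (F × F × F))
    (ε : F × F × F → F → Bool) (g : F × F × F → F × F × F → ℝ) :
    ∑ u, ∑ v, adjInd (quadrangleGraph L ε) u v * g u v =
      ∑ l ∈ L, ∑ a, ∑ b, (if ε l a ≠ ε l b then 1 else 0) *
        g (quadranglePoint l a) (quadranglePoint l b) := by
  classical
  let X : Finset ((F × F × F) × F × F) :=
    (L ×ˢ Finset.univ).filter fun t => ε t.1 t.2.1 ≠ ε t.1 t.2.2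
  let φ : (F × F × F) × F × F → (F × F × F) × (F × F × F) :=
    fun t => (quadranglePoint t.1 t.2.1, quadranglePoint t.1 t.2.2)
  have hφ : Set.InjOn φ X := by
    rintro ⟨l, a, b⟩ h ⟨l', a', b'⟩ - he
    have hne : ε l a ≠ ε l b := (Finset.mem_filter.1 h).2
    have h1 : quadranglePoint l a = quadranglePoint l' a' := congrArg Prod.fst he
    have h2 : quadranglePoint l b = quadranglePoint l' b' := congrArg Prod.snd he
    obtain rfl := quadranglePoint_line_unique (fun hab => hne (congrArg (ε l) hab)) h1 h2
    obtain rfl : a = a' := congrArg Prod.fst h1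
    obtain rfl : b = b' := congrArg Prod.fst h2
    rfl
  have himage : X.image φ =
      Finset.univ.filter fun p => (quadrangleGraph L ε).Adj p.1 p.2 := by
    ext ⟨u, v⟩
    simp only [X, φ, Finset.mem_image, Finset.mem_filter, Finset.mem_product, Finset.mem_univ,
      and_true, true_and, Prod.mk.injEq, Prod.exists]
    constructor
    · rintro ⟨x, y, z, a, b, ⟨hl, hab⟩, ha, hb⟩
      exact ⟨(x, y, z), hl, a, b, hab, ha, hb⟩
    · rintro ⟨⟨x, y, z⟩, hl, a, b, hab, ha, hb⟩
      exact ⟨x, y, z, a, b, ⟨hl, hab⟩, ha, hb⟩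
  calc ∑ u, ∑ v, adjInd (quadrangleGraph L ε) u v * g u v
      = ∑ p ∈ Finset.univ.filter (fun p : (F × F × F) × (F × F × F) =>
          (quadrangleGraph L ε).Adj p.1 p.2), g p.1 p.2 := by
        rw [Finset.sum_filter]
        refine Eq.trans ?_ (Fintype.sum_prod_type'
          fun u v => if (quadrangleGraph L ε).Adj u v then g u v else 0).symm
        refine Finset.sum_congr rfl fun u _ => Finset.sum_congr rfl fun v _ => ?_
        simp [adjInd]
    _ = ∑ t ∈ X, g (φ t).1 (φ t).2 := by
        rw [← himage, Finset.sum_image hφ]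
    _ = _ := by
        simp only [X, φ]
        rw [Finset.sum_filter, Finset.sum_product]
        refine Finset.sum_congr rfl fun l _ => ?_
        rw [← Finset.univ_product_univ, Finset.sum_product]
        refine Finset.sum_congr rfl fun a _ => Finset.sum_congr rfl fun b _ => ?_
        simp

theorem sum_ne_indicator_mul {ι : Type*} [Fintype ι] (η : ι → Bool) (x : ι → ℝ) :
    ∑ a, ∑ b, (if η a ≠ η b then 1 else 0) * (x a * x b) =
      ((∑ a, x a) ^ 2 - (∑ a, boolSign (η a) * x a) ^ 2) / 2 := by
  simp_rw [boolSign_ne_indicator]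
  rw [sq, sq, Finset.sum_mul_sum, Finset.sum_mul_sum, ← Finset.sum_sub_distrib, Finset.sum_div]
  refine Finset.sum_congr rfl fun a _ => ?_
  rw [← Finset.sum_sub_distrib, Finset.sum_div]
  exact Finset.sum_congr rfl fun b _ => by ring

/-- On each line the quadratic form is half the difference of two squares, and only the signed
square can help a cut. The hypothesis sums over all lines, so the bound holds for every subfamily
`L`. -/
theorem surplus_quadrangleGraph_le [Fintype F] [DecidableEq F] (L : Finset (F × F × F))
    {ε : F × F × F → F → Bool} {B : ℝ}
    (hε : ∀ x : F × F × F → Bool,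
      ∑ l, (∑ a, boolSign (ε l a) * boolSign (x (quadranglePoint l a))) ^ 2 ≤ B) :
    surplus (quadrangleGraph L ε) ≤ B / 8 := by
  obtain ⟨s, hs⟩ := exists_surplus_eq (quadrangleGraph L ε)
  have hx : ∀ v, boolSign (decide (v ∉ s)) = signOf s v := by
    intro v
    by_cases h : v ∈ s <;> simp [signOf, boolSign, h]
  have hs' := hε fun v => decide (v ∉ s)
  simp only [hx] at hs'
  rw [hs, quadForm, sum_adjInd_quadrangleGraph L ε fun u v => signOf s u * signOf s v]
  have h1 : ∀ l, -((∑ a, boolSign (ε l a) * signOf s (quadranglePoint l a)) ^ 2 / 2) ≤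
      ∑ a, ∑ b, (if ε l a ≠ ε l b then (1 : ℝ) else 0) *
        (signOf s (quadranglePoint l a) * signOf s (quadranglePoint l b)) := by
    intro l
    rw [sum_ne_indicator_mul (ε l) fun a => signOf s (quadranglePoint l a)]
    linarith [sq_nonneg (∑ a, signOf s (quadranglePoint l a))]
  have h2 := Finset.sum_le_sum (s := L) fun l _ => h1 l
  rw [Finset.sum_neg_distrib, ← Finset.sum_div] at h2
  have h3 : ∑ l ∈ L, (∑ a, boolSign (ε l a) * signOf s (quadranglePoint l a)) ^ 2 ≤ B := by
    exact (Finset.sum_le_univ_sum_of_nonneg fun l => sq_nonneg _).trans hs'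
  linarith

end Quadrangle

/-! ### Adjusting the number of edges, and the upper bound. -/

theorem surplus_le_of_le {V : Type*} [Fintype V] {G G' : SimpleGraph V} (h : G' ≤ G) :
    surplus G' ≤ surplus G + ((G.edgeSet.ncard : ℝ) - G'.edgeSet.ncard) / 2 := by
  have h1 : maxCut G' ≤ maxCut G := by
    refine Finset.sup_mono_fun fun s _ => Set.ncard_le_ncard ?_ (Set.toFinite _)
    exact SimpleGraph.edgeSet_mono fun u v huv => ⟨h huv.1, huv.2⟩
  have h2 : (maxCut G' : ℝ) ≤ maxCut G := by exact_mod_cast h1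
  unfold surplus
  linarith

theorem exists_subgraph_ncard_edgeSet_eq {V : Type*} [Finite V] (G : SimpleGraph V) {m : ℕ}
    (hm : m ≤ G.edgeSet.ncard) : ∃ G' ≤ G, G'.edgeSet.ncard = m := by
  obtain ⟨t, ht, htm⟩ := Set.exists_subset_card_eq hm
  have he : (SimpleGraph.fromEdgeSet t).edgeSet = t := by
    rw [SimpleGraph.edgeSet_fromEdgeSet, sdiff_eq_left, Set.disjoint_left]
    intro e he
    exact G.not_isDiag_of_mem_edgeSet (ht he)
  refine ⟨SimpleGraph.fromEdgeSet t, ?_, by rw [he, htm]⟩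
  rw [← SimpleGraph.edgeSet_subset_edgeSet, he]
  exact ht

theorem surplus_le_of_iso {V W : Type*} [Fintype V] [Fintype W] {G : SimpleGraph V}
    {H : SimpleGraph W} (e : G ≃g H) : surplus H ≤ surplus G := by
  obtain ⟨s, hs⟩ := exists_surplus_eq H
  have h : quadForm H (signOf s) = quadForm G fun v => signOf s (e v) := by
    unfold quadForm
    rw [← Equiv.sum_comp e.toEquiv]
    refine Finset.sum_congr rfl fun u _ => ?_
    rw [← Equiv.sum_comp e.toEquiv]
    refine Finset.sum_congr rfl fun v _ => ?_
    have : adjInd H (e u) (e v) = adjInd G u v := by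
      by_cases h : G.Adj u v
      · rw [adjInd_of_adj h, adjInd_of_adj (e.map_adj_iff.2 h)]
      · rw [adjInd_of_not_adj h, adjInd_of_not_adj fun h' => h (e.map_adj_iff.1 h')]
    exact congrArg (· * _) this
  rw [hs, h]
  refine neg_quadForm_le_surplus G _ fun v => ?_
  unfold signOf
  split_ifs <;> simp

theorem exists_mem_surplusValues_le {V W : Type*} [Fintype V] {G : SimpleGraph V}
    {H : SimpleGraph W} (hG : H.Free G) :
    ∃ x ∈ surplusValues G.edgeSet.ncard H, x ≤ surplus G := by
  let e := G.overFinIso rfl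
  refine ⟨surplus (G.overFin rfl), ⟨_, G.overFin rfl,
    (SimpleGraph.free_congr_right e).1 hG, ?_, rfl⟩, surplus_le_of_iso e⟩
  rw [← Nat.card_coe_set_eq, ← Nat.card_coe_set_eq]
  exact (Nat.card_congr e.mapEdgeSet).symm

/-- Add the terms one at a time: when the sum first reaches t, it overshoots by at most the last
term. -/
theorem exists_subset_sum_mem_Icc {ι : Type*} (c : ι → ℝ) {B t : ℝ}
    (hB : ∀ i, c i ≤ B) (hB0 : 0 ≤ B) (ht : 0 ≤ t) (S : Finset ι) (hS : t ≤ ∑ i ∈ S, c i) :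
    ∃ L : Finset ι, t ≤ ∑ i ∈ L, c i ∧ ∑ i ∈ L, c i ≤ t + B := by
  classical
  induction S using Finset.induction_on with
  | empty =>
    rw [Finset.sum_empty] at hS
    exact ⟨∅, by simpa using hS, by simpa using by linarith⟩
  | insert i S hi ih =>
    rcases le_total t (∑ i ∈ S, c i) with h | h
    · exact ih h
    · refine ⟨insert i S, hS, ?_⟩
      rw [Finset.sum_insert hi]
      linarith [hB i]

/-- Wheel-free graphs of small surplus, from geometries over a finite field. -/
theorem exists_mem_surplusValues_le_of_field (F : Type) [Field F] [Fintype F] {k m : ℕ}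
    (hk : 2 ≤ k) (hF : 16 ≤ Fintype.card F) (hm : 8 * m ≤ Fintype.card F ^ 5) :
    ∃ x ∈ surplusValues m (wheel (2 * k)), x ≤ 2 * (Fintype.card F : ℝ) ^ 4 := by
  classical
  set q : ℝ := (Fintype.card F : ℝ) with hq
  have hq16 : 16 ≤ q := by rw [hq]; exact_mod_cast hF
  have hmq : 8 * (m : ℝ) ≤ q ^ 5 := by rw [hq]; exact_mod_cast hm
  obtain ⟨ε, hε⟩ := exists_signs rfl (quadranglePoint (F := F))
  have hcard : 8 * (Fintype.card F : ℝ) * (Fintype.card (F × F × F) : ℝ) = 8 * q ^ 4 := by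
    rw [Fintype.card_prod, Fintype.card_prod, hq]
    push_cast
    ring
  rw [hcard] at hε
  let c : F × F × F → ℝ := fun l => ∑ a, ∑ b, if ε l a ≠ ε l b then (1 : ℝ) else 0
  have hc : ∀ l, c l = (q ^ 2 - (∑ a, boolSign (ε l a)) ^ 2) / 2 := by
    intro l
    have := sum_ne_indicator_mul (ε l) fun _ => 1
    simpa [c, hq] using this
  have hedges : ∀ L, 2 * ((quadrangleGraph L ε).edgeSet.ncard : ℝ) = ∑ l ∈ L, c l := by
    intro L
    have := sum_adjInd_quadrangleGraph L ε fun _ _ => 1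
    simp only [mul_one] at this
    rw [← sum_adjInd, this]
  have hcq : ∀ l, c l ≤ q ^ 2 := fun l => by
    rw [hc]
    linarith [sq_nonneg (∑ a, boolSign (ε l a)), sq_nonneg q]
  -- The constant sign vector in `hε` shows that the lines are nearly balanced: the sum is at least
  -- (q^5 - 8q^4)/2, which is at least q^5/4 because q ≥ 16.
  have htotal : 2 * (m : ℝ) ≤ ∑ l, c l := by
    have h1 := hε fun _ => false
    simp only [boolSign, Bool.false_eq_true, if_false, mul_one] at h1
    simp_rw [hc]
    rw [← Finset.sum_div, Finset.sum_sub_distrib, Finset.sum_const, Finset.card_univ,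
      nsmul_eq_mul, Fintype.card_prod, Fintype.card_prod]
    push_cast
    rw [← hq]
    have h2 : 16 * q ^ 4 ≤ q * q ^ 4 := mul_le_mul_of_nonneg_right hq16 (by positivity)
    have h3 : q * (q * q) * q ^ 2 = q ^ 5 := by ring
    have h4 : q * q ^ 4 = q ^ 5 := by ring
    simp only [boolSign]
    rw [h3]
    linarith
  obtain ⟨L, hL1, hL2⟩ := exists_subset_sum_mem_Icc c hcq (sq_nonneg q) (by positivity)
    Finset.univ htotal
  rw [← hedges] at hL1 hL2
  -- At most q^2/2 surplus edges remain to be deleted, which costs at most q^2/4.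
  obtain ⟨G, hGL, hGm⟩ := exists_subgraph_ncard_edgeSet_eq (quadrangleGraph L ε) (m := m)
    (by exact_mod_cast (by linarith : (m : ℝ) ≤ (quadrangleGraph L ε).edgeSet.ncard))
  have hfree : (wheel (2 * k)).Free G := wheel_free_of_no_triangle hk fun u v w h1 h2 h3 =>
    quadrangleGraph_no_triangle (hGL h1) (hGL h2) (hGL h3)
  obtain ⟨x, hx, hxG⟩ := exists_mem_surplusValues_le hfree
  rw [hGm] at hx
  refine ⟨x, hx, hxG.trans ?_⟩
  have h1 := surplus_le_of_le hGL
  have h2 := surplus_quadrangleGraph_le L hε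
  rw [hGm] at h1
  have h3 : q ^ 2 ≤ q ^ 4 := pow_le_pow_right₀ (by linarith) (by norm_num)
  linarith [sq_nonneg q]

theorem exists_mem_surplusValues_wheel_le {k m : ℕ} (hk : 2 ≤ k) (hm : 1 ≤ m) :
    ∃ x ∈ surplusValues m (wheel (2 * k)), x ≤ 2 * 34 ^ 4 * (m : ℝ) ^ (4 / 5 : ℝ) := by
  obtain ⟨t, ht, hmt, hmt'⟩ := rpow_fifth_identities (m := (m : ℝ)) (by exact_mod_cast hm)
  -- Bertrand's postulate gives a prime of order m^{1/5}. The factor 16 ensures p ≥ 16 and p^5 ≥ 8m;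
  -- rounding up gives p ≤ 2(16t + 1) ≤ 34t.
  obtain ⟨p, hp, hp1, hp2⟩ := Nat.exists_prime_lt_and_le_two_mul ⌈16 * t⌉₊
    (Nat.ceil_pos.2 (by linarith)).ne'
  have : Fact p.Prime := ⟨hp⟩
  have h1 : 16 * t ≤ p := (Nat.le_ceil _).trans (by exact_mod_cast hp1.le)
  have h2 : (p : ℝ) ≤ 34 * t := by
    have h3 : (⌈16 * t⌉₊ : ℝ) < 16 * t + 1 := Nat.ceil_lt_add_one (by linarith)
    have h4 : (p : ℝ) ≤ 2 * ⌈16 * t⌉₊ := by exact_mod_cast hp2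
    linarith
  obtain ⟨x, hx, hxp⟩ := exists_mem_surplusValues_le_of_field (ZMod p) (m := m) hk
    (by
      rw [ZMod.card]
      exact_mod_cast (by linarith : (16 : ℝ) ≤ p))
    (by
      rw [ZMod.card]
      have h3 : (16 * t) ^ 5 ≤ (p : ℝ) ^ 5 := pow_le_pow_left₀ (by linarith) h1 5
      have h4 : 8 * (m : ℝ) ≤ (p : ℝ) ^ 5 := by
        rw [hmt]
        nlinarith [pow_nonneg (by linarith : (0 : ℝ) ≤ t) 5]
      exact_mod_cast h4)
  refine ⟨x, hx, hxp.trans ?_⟩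
  rw [ZMod.card, hmt']
  calc 2 * (p : ℝ) ^ 4 ≤ 2 * (34 * t) ^ 4 := by gcongr
    _ = _ := by ring

end MaxCutSurplus

theorem mainTheorem6 (k : ℕ) (hk : 2 ≤ k) :
    ∃ c C : ℝ, 0 < c ∧ 0 < C ∧ ∀ m : ℕ, 1 ≤ m →
      c * (m : ℝ) ^ (4 / 5 : ℝ) ≤ MaxCutSurplus.sp m (MaxCutSurplus.wheel (2 * k)) ∧
        MaxCutSurplus.sp m (MaxCutSurplus.wheel (2 * k)) ≤ C * (m : ℝ) ^ (4 / 5 : ℝ) := by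
  have hk0 : (0 : ℝ) < k := by exact_mod_cast (by omega : 0 < k)
  refine ⟨1 / (4608 * (3 * k) ^ 2), 2 * 34 ^ 4, by positivity, by norm_num, fun m hm => ?_⟩
  obtain ⟨x, hx, hxm⟩ := MaxCutSurplus.exists_mem_surplusValues_wheel_le hk hm
  have hleast := MaxCutSurplus.sp_isLeast m (MaxCutSurplus.wheel (2 * k)) ⟨x, hx⟩
  refine ⟨?_, (hleast.2 hx).trans hxm⟩
  obtain ⟨n, G, hG, rfl, hGs⟩ := hleast.1
  rw [← hGs]
  exact MaxCutSurplus.surplus_ge_of_wheel_free hk hG hm
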